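/- Let $d\in\mathbb N$. For a bounded Lipschitz map $K:\mathbb R^d\to\mathbb R^d$ (that is, $K\in W^{1,\infty}$, identified with its continuous representative) put $\|K\|_{W^{1,\infty}}=\max(\|K\|_{L^\infty},\mathrm{Lip}(K))$, where $\mathrm{Lip}(K)=\|\nabla K\|_{L^\infty}$ is the least Lipschitz constant. Let $W_1$ denote the $1$-Wasserstein distance on $\mathbb R^d$, i.e. $W_1(\mu,\nu)$ is the infimum of $\int |x-y|\,\pi(dx,dy)$ over all couplings $\pi$ of $\mu$ and $\nu$. There are constants $\tilde C,\theta>0$ depending only on $d$ such that the following holds. Let $N\ge 1$, let $K\in W^{1,\infty}$, let $(w_{ij})_{1\le i,j\le N}$ be real weights, and let $(X_1,\dots,X_N)$ be random trajectories on a probability space which almost surely solve $$\frac{dX_i}{dt}=\sum_{j=1}^N w_{ij}\,K(X_i-X_j),\qquad t\ge 0 .$$ Assume that $X_1(0),\dots,X_N(0)$ are independent (not necessarily identically distributed) with $\mathbb E|X_i(0)|^2<\infty$, and that, for some $M\ge 0$ and $C>0$, $$\sup_{1\le i\le N}\sqrt{\mathbb E|X_i(0)|^2}\le M,\qquad \sup_{1\le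 i\le N}\sum_{j=1}^N|w_{ij}|\le C .$$ Let $f_i(t,\cdot)$ be the law of $X_i(t)$. Then the coupled system $$\partial_t\bar f_i+\operatorname{div}_x\Big(\bar f_i(t,x)\sum_{j=1}^N w_{ij}\int_{\mathbb R^d}K(x-y)\,\bar f_j(t,dy)\Big)=0,\qquad \bar f_i(0,\cdot)=f_i(0,\cdot),\qquad 1\le i\le N,$$ has exactly one weak solution $(\bar f_1,\dots,\bar f_N)$ on $[0,\infty)$ made of narrowly continuous curves of probability measures on $\mathbb R^d$ (the equation being tested against $\varphi\in C_c^\infty(\mathbb R^d)$ and integrated in time), and for every $t\ge 0$ $$\sup_{1\le i\le N}W_1\big(f_i(t,\cdot),\bar f_i(t,\cdot)\big)\le C_1(t)\,\sup_{1\le i,j\le N}|w_{ij}|^{1/2},$$ $$\mathbb E\,W_1\Big(\frac1N\sum_{i=1}^N\delta_{X_i(t)},\ \frac1N\sum_{i=1}^N\bar f_i(t,\cdot)\Big)\le \frac{\tilde C\,C_2(t)}{N^{\theta}}+C_1(t)\,\sup_{1\le i,j\le N}|w_{ij}|^{1/2},$$ where $$C_1(t)=\sqrt{\tfrac{2}{C}}\,\big(e^{2Ct\|K\|_{W^{1,\infty}}}-1\big),\qquad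 C_2(t)=\big(2M^2+2C^2\|K\|_{L^\infty}^2t^2\big)^{1/2}.$$ -/

import Mathlib

open Set MeasureTheory ProbabilityTheory
open scoped NNReal ENNReal

noncomputable section

namespace PropIndep

/-- The Euclidean space `ℝ^d`. -/
abbrev E (d : ℕ) : Type := EuclideanSpace ℝ (Fin d)

/-- `K ∈ W^{1,∞}(ℝ^d; ℝ^d)`. As `K` is evaluated pointwise, it is identified with its continuous
representative, so that `W^{1,∞}` is the space of bounded Lipschitz maps. -/
structure MemW1Inf {d : ℕ} (K : E d → E d) : Prop where
  bounded : ∃ A : ℝ, ∀ x, ‖K x‖ ≤ A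
  lipschitz : ∃ L : ℝ≥0, LipschitzWith L K

/-- `‖K‖_{L^∞}`, the supremum norm of the continuous map `K`. -/
def normLInf {d : ℕ} (K : E d → E d) : ℝ := ⨆ x, ‖K x‖

/-- The Lipschitz seminorm, i.e. the least Lipschitz constant; it equals `‖∇K‖_{L^∞}` (for the
operator norm of `∇K`). -/
def lipSeminorm {d : ℕ} (K : E d → E d) : ℝ := ((sInf {L : ℝ≥0 | LipschitzWith L K} : ℝ≥0) : ℝ)

/-- `‖K‖_{W^{1,∞}} = max (‖K‖_{L^∞}, ‖∇K‖_{L^∞})`. -/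
def normW1Inf {d : ℕ} (K : E d → E d) : ℝ := max (normLInf K) (lipSeminorm K)

/-- The `1`-Wasserstein distance: the infimum of the transport cost `∫ |x - y| dπ(x, y)` over all
couplings `π` of `μ` and `ν`. -/
def W1 {d : ℕ} (μ ν : Measure (E d)) : ℝ≥0∞ :=
  ⨅ (π : Measure (E d × E d)) (_ : π.map Prod.fst = μ ∧ π.map Prod.snd = ν),
    ∫⁻ p, edist p.1 p.2 ∂π

/-- The average `(1/N) ∑ μ_i` of `N` measures. -/
def avgMeasure {d N : ℕ} (μ : Fin N → Measure (E d)) : Measure (E d) :=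
  (N : ℝ≥0∞)⁻¹ • ∑ i, μ i

/-- The empirical measure `(1/N) ∑ δ_{x_i}`. -/
def empiricalMeasure {d N : ℕ} (x : Fin N → E d) : Measure (E d) :=
  avgMeasure fun i => Measure.dirac (x i)

/-- `(X_1, …, X_N)` are random trajectories on `(Ω, P)` that almost surely solve
`dX_i/dt = ∑_j w_ij K(X_i - X_j)` on `[0, ∞)`; the derivative at `0` is one-sided. -/
structure IsAgentSystem {d N : ℕ} {Ω : Type*} [MeasurableSpace Ω] (P : Measure Ω)
    (w : Fin N → Fin N → ℝ) (K : E d → E d) (X : ℝ → Fin N → Ω → E d) : Prop where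
  measurable : ∀ t, 0 ≤ t → ∀ i, Measurable (X t i)
  ode : ∀ᵐ ω ∂P, ∀ t, 0 ≤ t → ∀ i,
    HasDerivWithinAt (fun s => X s i ω) (∑ j, w i j • K (X t i ω - X t j ω)) (Ici 0) t

/-- The velocity field `x ↦ ∑_j w_ij ∫ K(x - y) f_j(dy)` felt by the `i`-th agent. -/
def velocity {d N : ℕ} (w : Fin N → Fin N → ℝ) (K : E d → E d)
    (f : Fin N → ProbabilityMeasure (E d)) (i : Fin N) (x : E d) : E d :=
  ∑ j, w i j • ∫ y, K (x - y) ∂(f j : Measure (E d))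

/-- `(f_1, …, f_N)` is a measure-valued weak solution on `[0, ∞)` of
`∂_t f_i + div_x (f_i ∑_j w_ij ∫ K(x - y) f_j(t, dy)) = 0`, `f_i(0) = f0_i`: a narrowly continuous
curve of probability measures that satisfies the equation against every smooth, compactly
supported test function. Only the values at times `t ≥ 0` matter. -/
structure IsMcKeanSolution {d N : ℕ} (w : Fin N → Fin N → ℝ) (K : E d → E d)
    (f0 : Fin N → Measure (E d)) (f : ℝ → Fin N → ProbabilityMeasure (E d)) : Prop where
  continuousOn : ∀ i, ContinuousOn (fun t => f t i) (Ici 0)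
  initial : ∀ i, (f 0 i : Measure (E d)) = f0 i
  weak : ∀ i, ∀ φ : E d → ℝ, ContDiff ℝ ((⊤ : ℕ∞) : WithTop ℕ∞) φ → HasCompactSupport φ → ∀ t, 0 ≤ t →
    ∫ x, φ x ∂(f t i : Measure (E d)) = ∫ x, φ x ∂(f 0 i : Measure (E d)) +
      ∫ s in (0 : ℝ)..t, ∫ x, fderiv ℝ φ x (velocity w K (f s) i x) ∂(f s i : Measure (E d))

/-- `C_1(t) = √(2/C) (exp(2 C t ‖K‖_{W^{1,∞}}) - 1)`. -/
def C1 {d : ℕ} (C : ℝ) (K : E d → E d) (t : ℝ) : ℝ :=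
  √(2 / C) * (Real.exp (2 * C * t * normW1Inf K) - 1)

/-- `C_2(t) = (2 M² + 2 C² ‖K‖_{L^∞}² t²)^{1/2}`. -/
def C2 {d : ℕ} (M C : ℝ) (K : E d → E d) (t : ℝ) : ℝ :=
  √(2 * M ^ 2 + 2 * C ^ 2 * normLInf K ^ 2 * t ^ 2)

end PropIndep

end

set_option maxSynthPendingDepth 3

/-! ### Mollification of Lipschitz test functions -/

noncomputable section

namespace PropIndep

open Filter Topology

variable {d : ℕ}

/-! The mean-field system has a flow: agent `i` follows the velocity created by the laws of all
agents, each law being the image of its initial law. Start this flow from the random points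
`X_i(0)`. The points `Φ_t^i(X_i(0))` are independent and have laws `fbar_i(t)`, so they are an
independent copy of the system, driven by the same initial data as the true trajectories.

The two systems differ only because the true interaction is a sum over agents and the mean-field one
is its expectation. For independent points the deviation is a sum of pairwise orthogonal terms, so
its `L^2` norm is at most `2‖K‖_∞ (∑_j w_ij^2)^{1/2}`, which is at most `2‖K‖_∞ √C sup|w_ij|^{1/2}`
(`integral_norm_interaction_sub_velocity_le`, `sqrt_sum_sq_le`). Grönwall applied to the largest of
the expected distances gives `IsMcKeanFlow.lintegral_edist_le`. The joint law of both points is a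
coupling, and this is the first estimate. For the second, add the distance from the empirical
measure of the independent points to its mean, which is controlled by second moments through a
finite grid (`exists_coupling`, `lintegral_W1_empirical_le`).

The flow is an autonomous ODE with bounded Lipschitz right-hand side in the Banach space of bounded
continuous displacements (`exists_mcKeanFlow`); its image measures solve the weak equation.

Uniqueness concerns arbitrary weak solutions, which carry no flow. Two of them are compared by
testing against mollified Lipschitz functions. Over a time `h` a solution agrees up to `O(h^2)` with
its explicit Euler step, and the step moves the velocity onto the test function. Composing with a
Lipschitz map loses smoothness but keeps the Lipschitz bound, and mollifying again costs `O(hδ)`.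
This is `SmoothClose.step`; a discrete Grönwall argument with `h → 0` and then `δ → 0` gives
`IsMcKeanSolution.unique`. -/

/-- The convolution of `θ` with a measure. -/
def smooth (m : Measure (E d)) (θ : E d → ℝ) (x : E d) : ℝ := ∫ z, θ (x - z) ∂m

/-- `m` is supported in the ball of radius `δ` and convolution with `m` turns compactly supported
`ℓ`-Lipschitz functions into test functions with `B ℓ`-Lipschitz derivative. -/
structure IsMollifier (m : Measure (E d)) (δ : ℝ) (B : ℝ≥0) : Prop where
  norm_le : ∀ᵐ z ∂m, ‖z‖ ≤ δ
  contDiff : ∀ {θ : E d → ℝ} {ℓ : ℝ≥0}, LipschitzWith ℓ θ → HasCompactSupport θ →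
    ContDiff ℝ ((⊤ : ℕ∞) : WithTop ℕ∞) (smooth m θ)
  hasCompactSupport : ∀ {θ : E d → ℝ} {ℓ : ℝ≥0}, LipschitzWith ℓ θ → HasCompactSupport θ →
    HasCompactSupport (smooth m θ)
  lipschitzWith_fderiv : ∀ {θ : E d → ℝ} {ℓ : ℝ≥0}, LipschitzWith ℓ θ → HasCompactSupport θ →
    LipschitzWith (B * ℓ) (fderiv ℝ (smooth m θ))

/-- Take for `m` the measure whose density is a normalized bump `ρ` of radius `δ`, so that `smooth m
θ = ρ * θ`. The derivative falls on `ρ`, hence `D(ρ * θ) = Dρ * θ` inherits the modulus of `θ` up to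
a multiple of `‖Dρ‖_{L^1}`. The constant `B` depends on `δ`, so later limits must take the time step
to zero before `δ`. -/
theorem exists_mollifier (d : ℕ) {δ : ℝ} (hδ : 0 < δ) :
    ∃ (m : Measure (E d)) (B : ℝ≥0), IsProbabilityMeasure m ∧ IsMollifier m δ B := by
  let b : ContDiffBump (0 : E d) := ⟨δ / 2, δ, half_pos hδ, half_lt_self hδ⟩
  let ρ : E d → ℝ := b.normed volume
  have hρ0 : ∀ x, 0 ≤ ρ x := fun x => b.nonneg_normed x
  have hρc : Continuous ρ := b.continuous_normed
  have hρs : HasCompactSupport ρ := b.hasCompactSupport_normed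
  have hρd : ContDiff ℝ ((⊤ : ℕ∞) : WithTop ℕ∞) ρ := b.contDiff_normed
  have hρi : Integrable ρ := b.integrable_normed
  let L : ℝ →L[ℝ] ℝ →L[ℝ] ℝ := ContinuousLinearMap.lsmul ℝ ℝ
  let B : ℝ := ‖L.precompL (E d)‖ * ∫ z, ‖fderiv ℝ ρ z‖
  have hB : 0 ≤ B := by positivity
  have hfi : Integrable (fun z => ‖fderiv ℝ ρ z‖) :=
    ((hρd.continuous_fderiv (by simp)).integrable_of_hasCompactSupport (hρs.fderiv ℝ)).norm
  suffices h : (∀ᵐ z ∂(volume.withDensity fun z => ENNReal.ofReal (ρ z)), ‖z‖ ≤ δ) ∧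
      ∀ (θ : E d → ℝ) (ℓ : ℝ≥0), LipschitzWith ℓ θ → HasCompactSupport θ →
        ContDiff ℝ ((⊤ : ℕ∞) : WithTop ℕ∞)
          (smooth (volume.withDensity fun z => ENNReal.ofReal (ρ z)) θ) ∧
        HasCompactSupport (smooth (volume.withDensity fun z => ENNReal.ofReal (ρ z)) θ) ∧
        LipschitzWith (B.toNNReal * ℓ)
          (fderiv ℝ (smooth (volume.withDensity fun z => ENNReal.ofReal (ρ z)) θ)) by
    refine ⟨volume.withDensity fun z => ENNReal.ofReal (ρ z), B.toNNReal, ⟨?_⟩, h.1,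
      fun hl hs => (h.2 _ _ hl hs).1, fun hl hs => (h.2 _ _ hl hs).2.1,
      fun hl hs => (h.2 _ _ hl hs).2.2⟩
    rw [withDensity_apply _ MeasurableSet.univ, Measure.restrict_univ,
      ← ofReal_integral_eq_lintegral_ofReal hρi (.of_forall hρ0), b.integral_normed]
    simp
  refine ⟨?_, ?_⟩
  · rw [ae_withDensity_iff (by fun_prop)]
    refine .of_forall fun z hz => ?_
    have hz' : ρ z ≠ 0 := by
      intro h; simp [h] at hz
    have : z ∈ Function.support ρ := hz'
    rw [show Function.support ρ = Metric.ball 0 δ from b.support_normed_eq] at this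
    simpa using (mem_ball_zero_iff.1 this).le
  · intro θ ℓ hθ hs
    have hθc := hθ.continuous
    have key : smooth (volume.withDensity fun z => ENNReal.ofReal (ρ z)) θ
        = convolution ρ θ L volume := by
      ext x
      rw [smooth, integral_withDensity_eq_integral_toReal_smul (by fun_prop)
        (.of_forall fun _ => ENNReal.ofReal_lt_top), convolution_def]
      refine integral_congr_ae (.of_forall fun z => ?_)
      simp [L, ENNReal.toReal_ofReal (hρ0 z)]
    rw [key]
    refine ⟨hρs.contDiff_convolution_left L hρd hθc.locallyIntegrable,
      hρs.convolution L hs, ?_⟩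
    refine LipschitzWith.of_dist_le_mul fun x y => ?_
    have hd : ContDiff ℝ 1 ρ := hρd.of_le (by exact_mod_cast le_top)
    rw [(hρs.hasFDerivAt_convolution_left L hd hθc.locallyIntegrable x).fderiv,
      (hρs.hasFDerivAt_convolution_left L hd hθc.locallyIntegrable y).fderiv, dist_eq_norm,
      convolution_def, convolution_def]
    have hI : ∀ x, Integrable (fun t => (L.precompL (E d)) (fderiv ℝ ρ t) (θ (x - t))) := fun x =>
      (hρs.fderiv ℝ).convolutionExists_left _ (hd.continuous_fderiv (by simp))
        hθc.locallyIntegrable x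
    rw [← integral_sub (hI x) (hI y)]
    calc _ ≤ ∫ t, ‖L.precompL (E d)‖ * ‖fderiv ℝ ρ t‖ * (ℓ * dist x y) := by
          refine norm_integral_le_of_norm_le ((hfi.const_mul _).mul_const _)
            (.of_forall fun t => ?_)
          rw [← map_sub]
          refine (ContinuousLinearMap.le_opNorm₂ _ _ _).trans ?_
          gcongr
          simpa [dist_eq_norm] using hθ.dist_le_mul (x - t) (y - t)
      _ = _ := by
          rw [integral_mul_const, integral_const_mul, NNReal.coe_mul, Real.coe_toNNReal _ hB]
          ring

section Mollify

variable {m : Measure (E d)} [IsProbabilityMeasure m] {δ : ℝ}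

theorem integrable_translate {θ : E d → ℝ} (hc : Continuous θ) (hs : HasCompactSupport θ)
    (x : E d) : Integrable (fun z => θ (x - z)) m := by
  obtain ⟨A, hA⟩ := hs.exists_bound_of_continuous hc
  exact Integrable.of_bound (by fun_prop) A (.of_forall fun z => hA _)

theorem abs_smooth_sub_smooth_le {θ θ' : E d → ℝ} (hc : Continuous θ) (hs : HasCompactSupport θ)
    (hc' : Continuous θ') (hs' : HasCompactSupport θ') {A : ℝ} {x y : E d}
    (h : ∀ᵐ z ∂m, |θ (x - z) - θ' (y - z)| ≤ A) : |smooth m θ x - smooth m θ' y| ≤ A := by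
  rw [smooth, smooth, ← integral_sub (integrable_translate hc hs x) (integrable_translate hc' hs' y)]
  have h' : ∀ᵐ z ∂m, ‖θ (x - z) - θ' (y - z)‖ ≤ A := h
  simpa using norm_integral_le_of_norm_le_const h'

theorem lipschitzWith_smooth {θ : E d → ℝ} {ℓ : ℝ≥0} (hl : LipschitzWith ℓ θ)
    (hs : HasCompactSupport θ) : LipschitzWith ℓ (smooth m θ) := by
  refine LipschitzWith.of_dist_le_mul fun x y => ?_
  refine abs_smooth_sub_smooth_le hl.continuous hs hl.continuous hs (.of_forall fun z => ?_)
  simpa [dist_eq_norm] using hl.dist_le_mul (x - z) (y - z)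

theorem abs_smooth_sub_le (hm : ∀ᵐ z ∂m, ‖z‖ ≤ δ) {θ : E d → ℝ} {ℓ : ℝ≥0}
    (hl : LipschitzWith ℓ θ) (hs : HasCompactSupport θ) (x : E d) :
    |smooth m θ x - θ x| ≤ ℓ * δ := by
  have h : θ x = ∫ _, θ x ∂m := by simp
  rw [smooth, h, ← integral_sub (integrable_translate hl.continuous hs x) (integrable_const _)]
  have h2 : ∀ᵐ z ∂m, ‖θ (x - z) - θ x‖ ≤ ℓ * δ := by
    filter_upwards [hm] with z hz
    refine (hl.norm_sub_le _ _).trans ?_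
    gcongr
    simpa using hz
  simpa using norm_integral_le_of_norm_le_const h2

end Mollify

/-! ### The dual Lipschitz distance -/

theorem integrable_of_bound {α : Type*} [TopologicalSpace α] [MeasurableSpace α]
    [OpensMeasurableSpace α] {F : Type*} [NormedAddCommGroup F] [MeasurableSpace F] [BorelSpace F]
    [SecondCountableTopology F]
    (μ : Measure α) [IsFiniteMeasure μ] {θ : α → F} (hc : Continuous θ) {A : ℝ}
    (hA : ∀ x, ‖θ x‖ ≤ A) : Integrable θ μ :=
  Integrable.of_bound hc.measurable.aestronglyMeasurable A (.of_forall hA)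

/-- `LipClose μ ν D`: the dual Lipschitz distance of `μ` and `ν` is at most `D`, tested against
compactly supported functions. -/
def LipClose (μ ν : Measure (E d)) (D : ℝ) : Prop :=
  ∀ (θ : E d → ℝ) (ℓ : ℝ≥0), LipschitzWith ℓ θ → HasCompactSupport θ →
    |∫ x, θ x ∂μ - ∫ x, θ x ∂ν| ≤ ℓ * D

/-- Mollifying moves `θ` by at most `ℓ δ` uniformly, and this is paid once for each measure. -/
theorem abs_integral_sub_le_of_smooth {μ ν : Measure (E d)} [IsProbabilityMeasure μ]
    [IsProbabilityMeasure ν] {m : Measure (E d)} [IsProbabilityMeasure m] {δ : ℝ}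
    (hm : ∀ᵐ z ∂m, ‖z‖ ≤ δ) {θ : E d → ℝ} {ℓ : ℝ≥0}
    (hl : LipschitzWith ℓ θ) (hs : HasCompactSupport θ) :
    |∫ x, θ x ∂μ - ∫ x, θ x ∂ν| ≤
      |∫ x, smooth m θ x ∂μ - ∫ x, smooth m θ x ∂ν| + 2 * (ℓ * δ) := by
  obtain ⟨A, hA⟩ := hs.exists_bound_of_continuous hl.continuous
  have hb : ∀ x, ‖smooth m θ x‖ ≤ A + ℓ * δ := fun x => by
    have h1 := abs_smooth_sub_le hm hl hs x
    have h2 := hA x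
    rw [Real.norm_eq_abs] at *
    have := abs_sub_abs_le_abs_sub (smooth m θ x) (θ x)
    linarith
  have main : ∀ (η : Measure (E d)) [IsProbabilityMeasure η],
      |∫ x, θ x ∂η - ∫ x, smooth m θ x ∂η| ≤ ℓ * δ := by
    intro η _
    rw [← integral_sub (integrable_of_bound η hl.continuous hA)
      (integrable_of_bound η (lipschitzWith_smooth hl hs).continuous hb)]
    have h2 : ∀ᵐ x ∂η, ‖θ x - smooth m θ x‖ ≤ ℓ * δ := .of_forall fun x => by
      rw [← norm_neg, neg_sub]; exact abs_smooth_sub_le hm hl hs x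
    simpa using norm_integral_le_of_norm_le_const h2
  have h1 := abs_le.1 (main μ)
  have h2 := abs_le.1 (main ν)
  have h3 := abs_le.1 (le_refl |∫ x, smooth m θ x ∂μ - ∫ x, smooth m θ x ∂ν|)
  rw [abs_le]
  constructor <;> linarith

theorem le_of_forall_pos_le_add_mul {a b c : ℝ} (h : ∀ δ : ℝ, 0 < δ → a ≤ b + c * δ) : a ≤ b := by
  have hl : Tendsto (fun δ : ℝ => b + c * δ) (𝓝[>] 0) (𝓝 (b + c * 0)) :=
    ((continuous_const.add (continuous_const.mul continuous_id)).tendsto 0).mono_left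
      nhdsWithin_le_nhds
  rw [mul_zero, add_zero] at hl
  exact ge_of_tendsto hl (eventually_nhdsWithin_of_forall fun δ hδ => h δ hδ)

theorem lipClose_of_contDiff {μ ν : Measure (E d)} [IsProbabilityMeasure μ]
    [IsProbabilityMeasure ν] {D : ℝ}
    (h : ∀ (φ : E d → ℝ) (ℓ : ℝ≥0), ContDiff ℝ ((⊤ : ℕ∞) : WithTop ℕ∞) φ → HasCompactSupport φ →
      LipschitzWith ℓ φ → |∫ x, φ x ∂μ - ∫ x, φ x ∂ν| ≤ ℓ * D) : LipClose μ ν D := by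
  intro θ ℓ hl hs
  have key : ∀ δ : ℝ, 0 < δ → |∫ x, θ x ∂μ - ∫ x, θ x ∂ν| ≤ ℓ * D + 2 * (ℓ * δ) := by
    intro δ hδ
    obtain ⟨m, B, hm, hB⟩ := exists_mollifier d hδ
    have := h _ ℓ (hB.contDiff hl hs) (hB.hasCompactSupport hl hs) (lipschitzWith_smooth hl hs)
    linarith [abs_integral_sub_le_of_smooth (μ := μ) (ν := ν) hB.norm_le hl hs]
  exact le_of_forall_pos_le_add_mul (c := 2 * ℓ) fun δ hδ => by linarith [key δ hδ]

/-- The cutoff `max 0 (1 - |x| / (n + 1))`. -/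
def cutoff (n : ℕ) (x : E d) : ℝ := max 0 (1 - ‖x‖ / (n + 1))

theorem cutoff_nonneg (n : ℕ) (x : E d) : 0 ≤ cutoff n x := le_max_left _ _

theorem cutoff_le_one (n : ℕ) (x : E d) : cutoff n x ≤ 1 :=
  max_le zero_le_one (by have : 0 ≤ ‖x‖ / (n + 1) := by positivity
                         linarith)

theorem abs_cutoff_sub_le (n : ℕ) (x y : E d) :
    |cutoff n x - cutoff n y| ≤ 1 / (n + 1) * dist x y := by
  have h1 := abs_max_sub_max_le_abs (1 - ‖x‖ / (n + 1)) (1 - ‖y‖ / (n + 1)) (0 : ℝ)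
  rw [cutoff, cutoff, max_comm, max_comm (0 : ℝ)]
  refine h1.trans ?_
  rw [show 1 - ‖x‖ / (n + 1) - (1 - ‖y‖ / (n + 1)) = 1 / (n + 1 : ℝ) * (‖y‖ - ‖x‖) by ring,
    abs_mul, abs_of_nonneg (by positivity : (0 : ℝ) ≤ 1 / (n + 1))]
  gcongr
  rw [dist_comm, dist_eq_norm]
  exact abs_norm_sub_norm_le y x

theorem hasCompactSupport_cutoff (n : ℕ) : HasCompactSupport (cutoff (d := d) n) := by
  refine HasCompactSupport.of_support_subset_isCompact (isCompact_closedBall (0 : E d) (n + 1))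
    fun x hx => ?_
  by_contra h
  rw [mem_closedBall_zero_iff, not_le] at h
  refine hx (max_eq_left ?_)
  rw [sub_nonpos, le_div_iff₀ (by positivity)]
  linarith

theorem tendsto_cutoff (x : E d) : Tendsto (fun n => cutoff n x) atTop (𝓝 1) := by
  have h : Tendsto (fun n : ℕ => 1 - ‖x‖ / ((n : ℝ) + 1)) atTop (𝓝 (1 - 0)) :=
    tendsto_const_nhds.sub
      (tendsto_const_nhds.div_atTop (tendsto_natCast_atTop_atTop.atTop_add tendsto_const_nhds))
  have h2 := (tendsto_const_nhds (x := (0 : ℝ))).max h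
  rwa [sub_zero, max_eq_right zero_le_one] at h2

/-- Compact support is removed by cutoffs of slope `1 / (n + 1)`: the truncated function has
Lipschitz constant `ℓ + A / (n + 1)`, so nothing is lost in the limit. -/
theorem LipClose.abs_integral_sub_le {μ ν : Measure (E d)} [IsProbabilityMeasure μ]
    [IsProbabilityMeasure ν] {D : ℝ} (h : LipClose μ ν D) {θ : E d → ℝ} {ℓ : ℝ≥0}
    (hl : LipschitzWith ℓ θ) {A : ℝ} (hA : ∀ x, |θ x| ≤ A) :
    |∫ x, θ x ∂μ - ∫ x, θ x ∂ν| ≤ ℓ * D := by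
  have hA0 : 0 ≤ A := (abs_nonneg _).trans (hA 0)
  have hcc : ∀ n, Continuous (cutoff (d := d) n) := fun n => by unfold cutoff; fun_prop
  have hlim : ∀ (η : Measure (E d)) [IsProbabilityMeasure η],
      Tendsto (fun n => ∫ x, θ x * cutoff n x ∂η) atTop (𝓝 (∫ x, θ x ∂η)) := by
    intro η _
    refine tendsto_integral_of_dominated_convergence (fun _ => A) (fun n => ?_)
      (integrable_const _) (fun n => .of_forall fun x => ?_) (.of_forall fun x => ?_)
    · exact (hl.continuous.mul (hcc n)).measurable.aestronglyMeasurable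
    · rw [norm_mul, Real.norm_eq_abs, Real.norm_eq_abs, abs_of_nonneg (cutoff_nonneg n x)]
      exact (mul_le_mul (hA x) (cutoff_le_one n x) (cutoff_nonneg n x) hA0).trans_eq (mul_one A)
    · simpa using (tendsto_cutoff x).const_mul (θ x)
  have hR : Tendsto (fun n : ℕ => (ℓ + A / ((n : ℝ) + 1)) * D) atTop (𝓝 ((ℓ + 0) * D)) :=
    (tendsto_const_nhds.add (tendsto_const_nhds.div_atTop
      (tendsto_natCast_atTop_atTop.atTop_add tendsto_const_nhds))).mul_const D
  rw [add_zero] at hR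
  refine le_of_tendsto_of_tendsto' ((hlim μ).sub (hlim ν)).abs hR fun n => ?_
  have hn : (0 : ℝ) ≤ ℓ + A / ((n : ℝ) + 1) := by positivity
  have hL : LipschitzWith (Real.toNNReal (ℓ + A / ((n : ℝ) + 1))) fun x => θ x * cutoff n x := by
    refine LipschitzWith.of_dist_le_mul fun x y => ?_
    rw [Real.coe_toNNReal _ hn, Real.dist_eq]
    have e : θ x * cutoff n x - θ y * cutoff n y
        = (θ x - θ y) * cutoff n x + θ y * (cutoff n x - cutoff n y) := by ring
    rw [e]
    refine (abs_add_le _ _).trans ?_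
    rw [abs_mul, abs_mul, abs_of_nonneg (cutoff_nonneg n x)]
    have h1 : |θ x - θ y| ≤ ℓ * dist x y := hl.dist_le_mul x y
    have h2 := mul_le_mul h1 (cutoff_le_one n x) (cutoff_nonneg n x) (by positivity)
    have h3 := mul_le_mul (hA y) (abs_cutoff_sub_le n x y) (abs_nonneg _) hA0
    calc _ ≤ ℓ * dist x y * 1 + A * (1 / (n + 1) * dist x y) := add_le_add h2 h3
      _ = _ := by ring
  have := h _ _ hL ((hasCompactSupport_cutoff n).mul_left)
  rwa [Real.coe_toNNReal _ hn] at this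

/-- The scalar bound is applied to `x ↦ ⟪a, k x⟫`, where `a` is the difference of the integrals
itself; this gives `‖a‖^2 ≤ ‖a‖ ℓ D`. -/
theorem LipClose.norm_integral_sub_le {μ ν : Measure (E d)} [IsProbabilityMeasure μ]
    [IsProbabilityMeasure ν] {D : ℝ} (h : LipClose μ ν D) (hD : 0 ≤ D) {k : E d → E d} {ℓ : ℝ≥0}
    (hl : LipschitzWith ℓ k) {A : ℝ} (hA : ∀ x, ‖k x‖ ≤ A) :
    ‖∫ x, k x ∂μ - ∫ x, k x ∂ν‖ ≤ ℓ * D := by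
  set a := ∫ x, k x ∂μ - ∫ x, k x ∂ν with ha
  have hL : LipschitzWith (‖a‖₊ * ℓ) fun x => inner ℝ a (k x) := by
    refine LipschitzWith.of_dist_le_mul fun x y => ?_
    rw [Real.dist_eq, ← inner_sub_right, NNReal.coe_mul, mul_assoc]
    refine (abs_real_inner_le_norm _ _).trans ?_
    rw [coe_nnnorm]
    gcongr
    rw [← dist_eq_norm]
    exact hl.dist_le_mul x y
  have h1 := h.abs_integral_sub_le hL (A := ‖a‖ * A) fun x =>
    (abs_real_inner_le_norm _ _).trans (by gcongr; exact hA x)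
  rw [integral_inner (integrable_of_bound μ hl.continuous hA),
    integral_inner (integrable_of_bound ν hl.continuous hA), ← inner_sub_right, ← ha,
    real_inner_self_eq_norm_sq, abs_of_nonneg (by positivity), NNReal.coe_mul, coe_nnnorm] at h1
  by_cases h0 : ‖a‖ = 0
  · rw [h0]; positivity
  · have : 0 < ‖a‖ := lt_of_le_of_ne (norm_nonneg _) (Ne.symm h0)
    refine le_of_mul_le_mul_left ?_ this
    nlinarith

/-- Bounded Lipschitz functions determine narrow convergence. The constant sequence `μ` thus
converges to `ν`, and the narrow topology is Hausdorff. -/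
theorem LipClose.eq {μ ν : ProbabilityMeasure (E d)}
    (h : LipClose (μ : Measure (E d)) (ν : Measure (E d)) 0) : μ = ν := by
  have : Tendsto (fun _ : ℕ => μ) atTop (𝓝 ν) := by
    rw [tendsto_iff_forall_lipschitz_integral_tendsto]
    rintro f ⟨A, hA⟩ ⟨L, hL⟩
    have hb : ∀ x, |f x| ≤ |f 0| + A := fun x => by
      have h1 := hA x 0
      rw [Real.dist_eq] at h1
      have := abs_sub_abs_le_abs_sub (f x) (f 0)
      linarith
    have h2 := h.abs_integral_sub_le hL hb
    rw [mul_zero] at h2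
    rw [sub_eq_zero.1 (abs_nonpos_iff.1 h2)]
    exact tendsto_const_nhds
  exact tendsto_nhds_unique tendsto_const_nhds this

end PropIndep

end

noncomputable section

namespace PropIndep

open Filter Topology

variable {d N : ℕ} {w : Fin N → Fin N → ℝ} {K : E d → E d} {L C A : ℝ≥0}

/-! ### The velocity field -/

theorem norm_sum_smul_le {F : Type*} [SeminormedAddCommGroup F] [NormedSpace ℝ F]
    (hw : ∀ i, ∑ j, |w i j| ≤ C) (i : Fin N) {a : Fin N → F} {D : ℝ} (hD : 0 ≤ D)
    (ha : ∀ j, ‖a j‖ ≤ D) : ‖∑ j, w i j • a j‖ ≤ C * D := by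
  refine (norm_sum_le _ _).trans ?_
  calc _ ≤ ∑ j, |w i j| * D := Finset.sum_le_sum fun j _ => by
        rw [norm_smul, Real.norm_eq_abs]
        exact mul_le_mul_of_nonneg_left (ha j) (abs_nonneg _)
    _ ≤ _ := by
        rw [← Finset.sum_mul]
        exact mul_le_mul_of_nonneg_right (hw i) hD

theorem norm_velocity_le (hA : ∀ x, ‖K x‖ ≤ A) (hw : ∀ i, ∑ j, |w i j| ≤ C)
    (f : Fin N → ProbabilityMeasure (E d)) (i : Fin N) (x : E d) :
    ‖velocity w K f i x‖ ≤ C * A := by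
  refine norm_sum_smul_le hw i A.2 fun j => ?_
  simpa using norm_integral_le_of_norm_le_const (μ := (f j : Measure (E d)))
    (.of_forall fun y => hA (x - y))

theorem lipschitzWith_integral_translate (hK : LipschitzWith L K) (hA : ∀ x, ‖K x‖ ≤ A)
    (η : Measure (E d)) [IsProbabilityMeasure η] : LipschitzWith L fun x => ∫ y, K (x - y) ∂η := by
  refine LipschitzWith.of_dist_le_mul fun x y => ?_
  have hKc := hK.continuous
  rw [dist_eq_norm, ← integral_sub (integrable_of_bound _ (by fun_prop) fun y => hA (x - y))
    (integrable_of_bound _ (by fun_prop) fun y' => hA (y - y'))]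
  simpa using norm_integral_le_of_norm_le_const (μ := η)
    (.of_forall fun z => by simpa [dist_eq_norm] using hK.dist_le_mul (x - z) (y - z))

theorem lipschitzWith_velocity (hK : LipschitzWith L K) (hA : ∀ x, ‖K x‖ ≤ A)
    (hw : ∀ i, ∑ j, |w i j| ≤ C) (f : Fin N → ProbabilityMeasure (E d)) (i : Fin N) :
    LipschitzWith (C * L) (velocity w K f i) := by
  refine LipschitzWith.of_dist_le_mul fun x y => ?_
  rw [dist_eq_norm, velocity, velocity, ← Finset.sum_sub_distrib]
  simp_rw [← smul_sub]
  rw [NNReal.coe_mul, mul_assoc]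
  refine norm_sum_smul_le hw i (by positivity) fun j => ?_
  rw [← dist_eq_norm]
  exact (lipschitzWith_integral_translate hK hA (f j : Measure (E d))).dist_le_mul x y

theorem norm_velocity_sub_le (hK : LipschitzWith L K) (hA : ∀ x, ‖K x‖ ≤ A)
    (hw : ∀ i, ∑ j, |w i j| ≤ C) {f g : Fin N → ProbabilityMeasure (E d)} {D : ℝ} (hD : 0 ≤ D)
    (h : ∀ j, LipClose (f j : Measure (E d)) (g j : Measure (E d)) D) (i : Fin N) (x : E d) :
    ‖velocity w K f i x - velocity w K g i x‖ ≤ (C * L : ℝ≥0) * D := by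
  rw [velocity, velocity, ← Finset.sum_sub_distrib]
  simp_rw [← smul_sub]
  rw [NNReal.coe_mul, mul_assoc]
  refine norm_sum_smul_le hw i (by positivity) fun j => ?_
  refine (h j).norm_integral_sub_le hD (k := fun y => K (x - y)) ?_ (A := A) fun y => hA _
  refine LipschitzWith.of_dist_le_mul fun y z => ?_
  simpa [dist_eq_norm, norm_sub_rev] using hK.dist_le_mul (x - y) (x - z)

/-! ### Time regularity of weak solutions -/

/-- The point of this form is that the integrand on the right is a bounded continuous function that
does not depend on `f`. Continuity in time then follows from narrow continuity of the product
measures. -/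
theorem integral_fderiv_velocity (hKc : Continuous K) (hA : ∀ x, ‖K x‖ ≤ A) {φ : E d → ℝ}
    (hφ : Continuous (fderiv ℝ φ)) {B : ℝ} (hB : ∀ x, ‖fderiv ℝ φ x‖ ≤ B)
    (f : Fin N → ProbabilityMeasure (E d)) (i : Fin N) :
    ∫ x, fderiv ℝ φ x (velocity w K f i x) ∂(f i : Measure (E d)) =
      ∑ j, w i j * ∫ p : E d × E d, fderiv ℝ φ p.1 (K (p.1 - p.2))
        ∂((f i).prod (f j) : Measure (E d × E d)) := by
  have hc : Continuous fun p : E d × E d => fderiv ℝ φ p.1 (K (p.1 - p.2)) := by fun_prop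
  have hb : ∀ p : E d × E d, ‖fderiv ℝ φ p.1 (K (p.1 - p.2))‖ ≤ B * A := fun p =>
    (ContinuousLinearMap.le_opNorm _ _).trans
      (mul_le_mul (hB _) (hA _) (norm_nonneg _) ((norm_nonneg _).trans (hB 0)))
  have hi : ∀ j, Integrable (fun p : E d × E d => fderiv ℝ φ p.1 (K (p.1 - p.2)))
      ((f i : Measure (E d)).prod (f j : Measure (E d))) := fun j =>
    integrable_of_bound _ hc hb
  simp_rw [ProbabilityMeasure.toMeasure_prod, integral_prod _ (hi _), velocity, map_sum, map_smul]
  rw [integral_finsetSum]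
  · refine Finset.sum_congr rfl fun j _ => ?_
    rw [← integral_const_mul]
    refine integral_congr_ae (.of_forall fun x => ?_)
    simp only [smul_eq_mul]
    rw [← ContinuousLinearMap.integral_comp_comm]
    exact integrable_of_bound _ (by fun_prop) fun y => hA _
  · intro j _
    suffices h : Integrable (fun x => fderiv ℝ φ x (∫ y, K (x - y) ∂(f j : Measure (E d))))
        (f i : Measure (E d)) from h.const_mul (w i j)
    refine (hi j).integral_prod_left.congr (.of_forall fun x => ?_)
    simp only
    rw [← ContinuousLinearMap.integral_comp_comm]
    exact integrable_of_bound _ (by fun_prop) fun y => hA _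

section Solution

variable {f0 : Fin N → Measure (E d)} {g : ℝ → Fin N → ProbabilityMeasure (E d)}

theorem IsMcKeanSolution.continuousOn_integral_fderiv (hg : IsMcKeanSolution w K f0 g)
    (hKc : Continuous K) (hA : ∀ x, ‖K x‖ ≤ A) {φ : E d → ℝ}
    (hφ : Continuous (fderiv ℝ φ)) {B : ℝ} (hB : ∀ x, ‖fderiv ℝ φ x‖ ≤ B) (i : Fin N) :
    ContinuousOn (fun s => ∫ x, fderiv ℝ φ x (velocity w K (g s) i x) ∂(g s i : Measure (E d)))
      (Ici 0) := by
  simp_rw [integral_fderiv_velocity hKc hA hφ hB]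
  refine continuousOn_finsetSum _ fun j _ => continuousOn_const.mul ?_
  let ψ : BoundedContinuousFunction (E d × E d) ℝ :=
    BoundedContinuousFunction.ofNormedAddCommGroup
      (fun p : E d × E d => fderiv ℝ φ p.1 (K (p.1 - p.2))) (by fun_prop) (B * A) fun p =>
        (ContinuousLinearMap.le_opNorm _ _).trans
          (mul_le_mul (hB _) (hA _) (norm_nonneg _) ((norm_nonneg _).trans (hB 0)))
  intro s hs
  have h1 : Tendsto (fun t => (g t i).prod (g t j)) (𝓝[Ici 0] s) (𝓝 ((g s i).prod (g s j))) :=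
    (ProbabilityMeasure.continuous_prod.tendsto (g s i, g s j)).comp
      ((hg.continuousOn i s hs).prodMk_nhds (hg.continuousOn j s hs))
  exact ProbabilityMeasure.tendsto_iff_forall_integral_tendsto.1 h1 ψ

theorem IsMcKeanSolution.integral_sub_eq (hg : IsMcKeanSolution w K f0 g)
    (hKc : Continuous K) (hA : ∀ x, ‖K x‖ ≤ A) {φ : E d → ℝ}
    (hφ : ContDiff ℝ ((⊤ : ℕ∞) : WithTop ℕ∞) φ) (hs : HasCompactSupport φ)
    (i : Fin N) {s t : ℝ} (hs0 : 0 ≤ s) (ht0 : 0 ≤ t) :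
    IntervalIntegrable (fun r => ∫ x, fderiv ℝ φ x (velocity w K (g r) i x)
      ∂(g r i : Measure (E d))) volume s t ∧
    ∫ x, φ x ∂(g t i : Measure (E d)) - ∫ x, φ x ∂(g s i : Measure (E d)) =
      ∫ r in s..t, ∫ x, fderiv ℝ φ x (velocity w K (g r) i x) ∂(g r i : Measure (E d)) := by
  have hc := hφ.continuous_fderiv (by simp)
  obtain ⟨B, hB⟩ := (hs.fderiv ℝ).exists_bound_of_continuous hc
  have hcont := hg.continuousOn_integral_fderiv hKc hA hc hB i
  have hint : ∀ {a b : ℝ}, 0 ≤ a → 0 ≤ b → IntervalIntegrable (fun r =>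
      ∫ x, fderiv ℝ φ x (velocity w K (g r) i x) ∂(g r i : Measure (E d))) volume a b := by
    intro a b ha hb
    refine (hcont.mono fun r hr => ?_).intervalIntegrable
    exact (le_min ha hb).trans hr.1
  refine ⟨hint hs0 ht0, ?_⟩
  rw [hg.weak i φ hφ hs t ht0, hg.weak i φ hφ hs s hs0, add_sub_add_left_eq_sub,
    intervalIntegral.integral_interval_sub_left (hint le_rfl ht0) (hint le_rfl hs0)]

/-- The speed is at most `C A`, so testing the equation against a smooth `ℓ`-Lipschitz function
gives a rate of change of at most `ℓ C A`. -/
theorem IsMcKeanSolution.lipClose (hg : IsMcKeanSolution w K f0 g)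
    (hKc : Continuous K) (hA : ∀ x, ‖K x‖ ≤ A) (hw : ∀ i, ∑ j, |w i j| ≤ C)
    (i : Fin N) {s t : ℝ} (hs0 : 0 ≤ s) (ht0 : 0 ≤ t) :
    LipClose (g t i : Measure (E d)) (g s i : Measure (E d)) (C * A * |t - s|) := by
  refine lipClose_of_contDiff fun φ ℓ hφ hs hl => ?_
  rw [(hg.integral_sub_eq hKc hA hφ hs i hs0 ht0).2, ← mul_assoc]
  refine intervalIntegral.norm_integral_le_of_norm_le_const (E := ℝ) fun r _ => ?_
  have : ∀ x, ‖fderiv ℝ φ x (velocity w K (g r) i x)‖ ≤ ℓ * (C * A) := fun x =>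
    (ContinuousLinearMap.le_opNorm _ _).trans (mul_le_mul (norm_fderiv_le_of_lipschitz ℝ hl (x₀ := x))
      (norm_velocity_le hA hw _ _ _) (norm_nonneg _) ℓ.2)
  simpa using norm_integral_le_of_norm_le_const (μ := (g r i : Measure (E d))) (.of_forall this)

theorem abs_sub_sub_fderiv_le {φ : E d → ℝ} (hφ : Differentiable ℝ φ) {B : ℝ≥0}
    (hB : LipschitzWith B (fderiv ℝ φ)) (x u : E d) :
    |φ (x + u) - φ x - fderiv ℝ φ x u| ≤ B * ‖u‖ ^ 2 := by
  have h := Convex.norm_image_sub_le_of_norm_fderiv_le' (𝕜 := ℝ) (f := φ) (φ := fderiv ℝ φ x)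
    (C := B * ‖u‖) (s := Metric.closedBall x ‖u‖) (x := x) (y := x + u)
    (fun y _ => hφ y) (fun y hy => ?_) (convex_closedBall x ‖u‖) (by simp) (by simp)
  · simpa [pow_two, mul_assoc] using h
  · rw [← dist_eq_norm]
    exact (hB.dist_le_mul y x).trans (by gcongr; exact hy)

/-- One explicit Euler step approximates a weak solution up to second order. -/
theorem IsMcKeanSolution.abs_integral_sub_euler_le (hg : IsMcKeanSolution w K f0 g)
    (hK : LipschitzWith L K) (hA : ∀ x, ‖K x‖ ≤ A) (hw : ∀ i, ∑ j, |w i j| ≤ C) {φ : E d → ℝ}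
    (hφ : ContDiff ℝ ((⊤ : ℕ∞) : WithTop ℕ∞) φ) (hs : HasCompactSupport φ) {ℓ B : ℝ≥0}
    (hl : LipschitzWith ℓ φ) (hB : LipschitzWith (B * ℓ) (fderiv ℝ φ))
    (i : Fin N) {t h : ℝ} (ht : 0 ≤ t) (hh : 0 ≤ h) :
    |∫ x, φ x ∂(g (t + h) i : Measure (E d)) -
        ∫ x, φ (x + h • velocity w K (g t) i x) ∂(g t i : Measure (E d))| ≤
      ℓ * ((2 * (C * L) * (C * A) + 2 * B * (C * A) ^ 2) * h ^ 2) := by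
  have hc := hφ.continuous_fderiv (by simp)
  have hKc := hK.continuous
  set V : ℝ≥0 := C * A with hV
  set Λ : ℝ≥0 := C * L with hΛ
  have hvL := fun s => lipschitzWith_velocity hK hA hw (g s) i
  have hvc := fun s => (hvL s).continuous
  have hvb := fun s => norm_velocity_le hA hw (g s) i
  have hφb : ∀ x, ‖fderiv ℝ φ x‖ ≤ ℓ := fun x => norm_fderiv_le_of_lipschitz ℝ hl
  obtain ⟨hint, heq⟩ := hg.integral_sub_eq hKc hA hφ hs i ht (add_nonneg ht hh)
  set q : ℝ → ℝ := fun r => ∫ x, fderiv ℝ φ x (velocity w K (g r) i x) ∂(g r i : Measure (E d))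
    with hq
  have hcs : ∀ s, HasCompactSupport fun x => fderiv ℝ φ x (velocity w K (g s) i x) := fun s => by
    refine (hs.fderiv ℝ).mono fun x hx h0 => hx ?_
    simp only [h0, zero_apply]
  have hinte : ∀ s r, Integrable (fun x => fderiv ℝ φ x (velocity w K (g s) i x))
      (g r i : Measure (E d)) := fun s r =>
    ((hc.clm_apply (hvc s))).integrable_of_hasCompactSupport (hcs s)
  -- With the velocity frozen at time `t` the integrand is Lipschitz, so it is an admissible test
  -- function for `LipClose`.
  have hθ : LipschitzWith (ℓ * (B * V + Λ))
      (fun x => fderiv ℝ φ x (velocity w K (g t) i x)) := by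
    refine LipschitzWith.of_dist_le_mul fun x y => ?_
    have e : fderiv ℝ φ x (velocity w K (g t) i x) - fderiv ℝ φ y (velocity w K (g t) i y)
      = (fderiv ℝ φ x - fderiv ℝ φ y) (velocity w K (g t) i x) +
        fderiv ℝ φ y (velocity w K (g t) i x - velocity w K (g t) i y) := by
      simp [map_sub]
    rw [dist_eq_norm, e]
    refine (norm_add_le _ _).trans ?_
    have h1 : ‖(fderiv ℝ φ x - fderiv ℝ φ y) (velocity w K (g t) i x)‖
        ≤ (B * ℓ) * dist x y * V := by
      refine (ContinuousLinearMap.le_opNorm _ _).trans ?_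
      refine mul_le_mul ?_ (hvb t x) (norm_nonneg _) (by positivity)
      rw [← dist_eq_norm]
      exact hB.dist_le_mul x y
    have h2 : ‖fderiv ℝ φ y (velocity w K (g t) i x - velocity w K (g t) i y)‖
        ≤ ℓ * (Λ * dist x y) := by
      refine (ContinuousLinearMap.le_opNorm _ _).trans ?_
      refine mul_le_mul (hφb y) ?_ (norm_nonneg _) (by positivity)
      rw [← dist_eq_norm]
      exact (hvL t).dist_le_mul x y
    refine (add_le_add h1 h2).trans_eq ?_
    push_cast
    ring
  -- Two contributions: replacing the velocity at time `r` by that at time `t`, and then the measure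
  -- at time `r` by that at time `t`. Both rest on the Lipschitz bound in time.
  have hqq : ∀ r, t ≤ r → |q r - q t| ≤ ℓ * (2 * Λ * V + B * V ^ 2) * (r - t) := by
    intro r hr
    have hclose : ∀ j, LipClose (g r j : Measure (E d)) (g t j : Measure (E d)) (V * (r - t)) := by
      intro j
      have := hg.lipClose hKc hA hw j ht (ht.trans hr)
      rwa [abs_of_nonneg (sub_nonneg.2 hr)] at this
    have h1 := hclose i _ _ hθ (hcs t)
    have h2 : |q r - ∫ x, fderiv ℝ φ x (velocity w K (g t) i x) ∂(g r i : Measure (E d))|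
        ≤ ℓ * (Λ * (V * (r - t))) := by
      rw [hq]
      simp only
      rw [← integral_sub (hinte r r) (hinte t r)]
      have : ∀ x, ‖fderiv ℝ φ x (velocity w K (g r) i x) - fderiv ℝ φ x (velocity w K (g t) i x)‖
          ≤ ℓ * (Λ * (V * (r - t))) := by
        intro x
        rw [← map_sub]
        refine (ContinuousLinearMap.le_opNorm _ _).trans ?_
        refine mul_le_mul (hφb x) ?_ (norm_nonneg _) ℓ.2
        exact norm_velocity_sub_le hK hA hw (mul_nonneg V.2 (sub_nonneg.2 hr)) hclose i x
      simpa using norm_integral_le_of_norm_le_const (μ := (g r i : Measure (E d)))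
        (.of_forall this)
    have h3 := abs_sub_le (q r) (∫ x, fderiv ℝ φ x (velocity w K (g t) i x)
      ∂(g r i : Measure (E d))) (q t)
    refine h3.trans ((add_le_add h2 h1).trans_eq ?_)
    push_cast
    ring
  have hI : |(∫ r in t..t + h, q r) - h * q t| ≤ ℓ * (2 * Λ * V + B * V ^ 2) * h ^ 2 := by
    have e : h * q t = ∫ _ in t..t + h, q t := by simp
    rw [e, ← intervalIntegral.integral_sub hint (by simp)]
    have := intervalIntegral.norm_integral_le_of_norm_le_const (a := t) (b := t + h)
      (f := fun r => q r - q t) (C := ℓ * (2 * Λ * V + B * V ^ 2) * h) ?_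
    · refine this.trans_eq ?_
      rw [add_sub_cancel_left, abs_of_nonneg hh]
      ring
    · intro r hr
      rw [uIoc_of_le (by linarith)] at hr
      refine (hqq r hr.1.le).trans ?_
      gcongr
      linarith [hr.2]
  -- Second-order Taylor remainder of `φ` along the Euler displacement.
  have hT : |∫ x, φ (x + h • velocity w K (g t) i x) ∂(g t i : Measure (E d))
      - ∫ x, φ x ∂(g t i : Measure (E d)) - h * q t| ≤ ℓ * (B * V ^ 2) * h ^ 2 := by
    obtain ⟨M, hM⟩ := hs.exists_bound_of_continuous hφ.continuous
    have i1 : Integrable (fun x => φ (x + h • velocity w K (g t) i x)) (g t i : Measure (E d)) :=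
      integrable_of_bound _ (hφ.continuous.comp
        (continuous_id.add ((hvc t).const_smul h))) fun x => hM _
    have i2 : Integrable φ (g t i : Measure (E d)) := integrable_of_bound _ hφ.continuous hM
    rw [hq]
    simp only
    rw [← integral_const_mul, ← integral_sub i1 i2,
      ← integral_sub (f := fun x => φ (x + h • velocity w K (g t) i x) - φ x) (i1.sub i2)
        ((hinte t t).const_mul h)]
    have : ∀ x, ‖φ (x + h • velocity w K (g t) i x) - φ x
        - h * fderiv ℝ φ x (velocity w K (g t) i x)‖ ≤ ℓ * (B * V ^ 2) * h ^ 2 := by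
      intro x
      have := abs_sub_sub_fderiv_le (hφ.differentiable (by simp)) hB x
        (h • velocity w K (g t) i x)
      rw [map_smul, smul_eq_mul] at this
      refine this.trans ?_
      rw [norm_smul, Real.norm_eq_abs, mul_pow, sq_abs]
      calc _ ≤ ((B * ℓ : ℝ≥0) : ℝ) * (h ^ 2 * (V : ℝ) ^ 2) := by
            gcongr
            exact hvb t x
        _ = _ := by push_cast; ring
    simpa using norm_integral_le_of_norm_le_const (μ := (g t i : Measure (E d))) (.of_forall this)
  have e : ∫ x, φ x ∂(g (t + h) i : Measure (E d)) -
        ∫ x, φ (x + h • velocity w K (g t) i x) ∂(g t i : Measure (E d)) =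
      ((∫ r in t..t + h, q r) - h * q t) -
      (∫ x, φ (x + h • velocity w K (g t) i x) ∂(g t i : Measure (E d))
      - ∫ x, φ x ∂(g t i : Measure (E d)) - h * q t) := by
    rw [← heq]; ring
  rw [e]
  refine (abs_sub _ _).trans ((add_le_add hI hT).trans_eq ?_)
  rw [hΛ, hV]
  push_cast
  ring

end Solution

/-! ### Uniqueness of weak solutions -/

theorem HasCompactSupport.comp_id_add {θ : E d → ℝ} (hs : HasCompactSupport θ)
    {u : E d → E d} {V : ℝ} (hV : ∀ x, ‖u x‖ ≤ V) : HasCompactSupport fun x => θ (x + u x) := by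
  obtain ⟨R, hR⟩ := hs.isCompact.isBounded.subset_closedBall (0 : E d)
  refine HasCompactSupport.of_support_subset_isCompact (isCompact_closedBall (0 : E d) (R + V))
    fun x hx => ?_
  have h1 := hR (subset_closure hx)
  rw [mem_closedBall_zero_iff] at h1 ⊢
  have h2 := norm_sub_le (x + u x) (u x)
  rw [add_sub_cancel_right] at h2
  linarith [hV x]

theorem LipschitzWith.comp_id_add_smul {θ : E d → ℝ} {ℓ Λ : ℝ≥0} (hl : LipschitzWith ℓ θ)
    {u : E d → E d} (hu : LipschitzWith Λ u) {h : ℝ} (hh : 0 ≤ h) :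
    LipschitzWith (ℓ * (1 + h.toNNReal * Λ)) fun x => θ (x + h • u x) := by
  refine LipschitzWith.of_dist_le_mul fun x y => ?_
  refine (hl.dist_le_mul _ _).trans ?_
  push_cast
  rw [Real.coe_toNNReal _ hh, mul_assoc]
  gcongr
  refine (dist_add_add_le _ _ _ _).trans ?_
  rw [dist_smul₀, Real.norm_of_nonneg hh]
  have := hu.dist_le_mul x y
  have := mul_le_mul_of_nonneg_left this hh
  linarith

theorem abs_integral_sub_integral_le {η : Measure (E d)} [IsProbabilityMeasure η]
    {f g : E d → ℝ} (hf : Continuous f) (hfs : HasCompactSupport f) (hg : Continuous g)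
    (hgs : HasCompactSupport g) {D : ℝ} (h : ∀ x, |f x - g x| ≤ D) :
    |∫ x, f x ∂η - ∫ x, g x ∂η| ≤ D := by
  rw [← integral_sub (hf.integrable_of_hasCompactSupport hfs)
    (hg.integrable_of_hasCompactSupport hgs)]
  have h' : ∀ x, ‖f x - g x‖ ≤ D := h
  simpa using norm_integral_le_of_norm_le_const (μ := η) (.of_forall h')

/-- The dual Lipschitz distances of the mollifications of `f i` and `g i` are at most `D`. -/
def SmoothClose (m : Measure (E d)) (f g : Fin N → ProbabilityMeasure (E d)) (D : ℝ) : Prop :=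
  ∀ (i : Fin N) (θ : E d → ℝ) (ℓ : ℝ≥0), LipschitzWith ℓ θ → HasCompactSupport θ →
    |∫ x, smooth m θ x ∂(f i : Measure (E d)) - ∫ x, smooth m θ x ∂(g i : Measure (E d))| ≤ ℓ * D

section Step

variable {m : Measure (E d)} [IsProbabilityMeasure m] {δ : ℝ} {B : ℝ≥0}

theorem SmoothClose.lipClose (hm : ∀ᵐ z ∂m, ‖z‖ ≤ δ) {f g : Fin N → ProbabilityMeasure (E d)}
    {D : ℝ} (h : SmoothClose m f g D) (i : Fin N) :
    LipClose (f i : Measure (E d)) (g i : Measure (E d)) (D + 2 * δ) := by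
  intro θ ℓ hl hs
  linarith [h i θ ℓ hl hs,
    abs_integral_sub_le_of_smooth (μ := (f i : Measure (E d))) (ν := (g i : Measure (E d))) hm hl hs]

/-- Mollification and transport by `x + h u(x)` almost commute: the discrepancy is `h (u(x) - u(x -
z))` with `‖z‖ ≤ δ`. The gain of the factor `h` is essential, as this error is incurred at every
time step. -/
theorem IsMollifier.abs_integral_smooth_comp_sub_le (hm : IsMollifier m δ B)
    {η : Measure (E d)} [IsProbabilityMeasure η] {θ : E d → ℝ} {ℓ Λ : ℝ≥0}
    (hl : LipschitzWith ℓ θ) (hs : HasCompactSupport θ) {u : E d → E d} (hu : LipschitzWith Λ u)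
    {V : ℝ} (hV : ∀ x, ‖u x‖ ≤ V) {h : ℝ} (hh : 0 ≤ h) :
    |∫ x, smooth m θ (x + h • u x) ∂η - ∫ x, smooth m (fun y => θ (y + h • u y)) x ∂η| ≤
      ℓ * (h * Λ * δ) := by
  have hV' : ∀ x, ‖h • u x‖ ≤ h * V := fun x => by
    rw [norm_smul, Real.norm_of_nonneg hh]
    exact mul_le_mul_of_nonneg_left (hV x) hh
  have hl' := LipschitzWith.comp_id_add_smul hl hu hh
  have hs' := HasCompactSupport.comp_id_add hs hV'
  have hsc := (lipschitzWith_smooth (m := m) hl hs).continuous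
  have huc := hu.continuous
  refine abs_integral_sub_integral_le (by fun_prop)
    (HasCompactSupport.comp_id_add (hm.hasCompactSupport hl hs) hV')
    (lipschitzWith_smooth hl' hs').continuous (hm.hasCompactSupport hl' hs') fun x => ?_
  refine abs_smooth_sub_smooth_le hl.continuous hs hl'.continuous hs' ?_
  filter_upwards [hm.norm_le] with z hz
  refine (hl.norm_sub_le _ _).trans ?_
  gcongr
  rw [show x + h • u x - z - (x - z + h • u (x - z)) = h • (u x - u (x - z)) by
    rw [smul_sub]; abel, norm_smul, Real.norm_of_nonneg hh, mul_assoc]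
  gcongr
  refine (hu.norm_sub_le _ _).trans ?_
  gcongr
  simpa using hz

/-- Chain for one Euler step: replace both solutions by their Euler steps (`h^2` terms), move the
mollifier outside the transport (`h Λ δ` for each solution, with `Λ = C L`), use the hypothesis for
the test function transported by the first velocity (Lipschitz constant `ℓ (1 + h Λ)`), and exchange
the two velocities (`h Λ (D + 2 δ)`). -/
theorem SmoothClose.step (hm : IsMollifier m δ B) (hδ : 0 ≤ δ)
    {f0 f0' : Fin N → Measure (E d)} {g g' : ℝ → Fin N → ProbabilityMeasure (E d)}
    (hg : IsMcKeanSolution w K f0 g) (hg' : IsMcKeanSolution w K f0' g')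
    (hK : LipschitzWith L K) (hA : ∀ x, ‖K x‖ ≤ A) (hw : ∀ i, ∑ j, |w i j| ≤ C)
    {t h D : ℝ} (ht : 0 ≤ t) (hh : 0 ≤ h) (hD : 0 ≤ D) (hc : SmoothClose m (g t) (g' t) D) :
    SmoothClose m (g (t + h)) (g' (t + h)) ((1 + h * (2 * (C * L))) * D +
      (h * (4 * (C * L) * δ) +
        h ^ 2 * (2 * (2 * (C * L) * (C * A) + 2 * B * (C * A) ^ 2)))) := by
  intro i θ ℓ hl hs
  have hφ := hm.contDiff hl hs
  have hφs := hm.hasCompactSupport hl hs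
  have hφl := lipschitzWith_smooth (m := m) hl hs
  have a1 := hg.abs_integral_sub_euler_le hK hA hw hφ hφs hφl (hm.lipschitzWith_fderiv hl hs) i
    ht hh
  have a1' := hg'.abs_integral_sub_euler_le hK hA hw hφ hφs hφl (hm.lipschitzWith_fderiv hl hs) i
    ht hh
  have hv := lipschitzWith_velocity hK hA hw (g t) i
  have hv' := lipschitzWith_velocity hK hA hw (g' t) i
  have hb := norm_velocity_le hA hw (g t) i
  have hb' := norm_velocity_le hA hw (g' t) i
  have a2 := hm.abs_integral_smooth_comp_sub_le (η := (g t i : Measure (E d))) hl hs hv hb hh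
  have a2' := hm.abs_integral_smooth_comp_sub_le (η := (g' t i : Measure (E d))) hl hs hv' hb' hh
  have hsm : ∀ {u : E d → E d} {V : ℝ}, (∀ x, ‖u x‖ ≤ V) →
      HasCompactSupport fun x => θ (x + h • u x) := fun {u V} hu =>
    HasCompactSupport.comp_id_add hs (V := h * V) fun x => by
      rw [norm_smul, Real.norm_of_nonneg hh]
      exact mul_le_mul_of_nonneg_left (hu x) hh
  have hl1 := LipschitzWith.comp_id_add_smul hl hv hh
  have hl2 := LipschitzWith.comp_id_add_smul hl hv' hh
  have a3 := hc i _ _ hl1 (hsm hb)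
  have a4 : |∫ x, smooth m (fun y => θ (y + h • velocity w K (g t) i y)) x ∂(g' t i : Measure (E d))
      - ∫ x, smooth m (fun y => θ (y + h • velocity w K (g' t) i y)) x ∂(g' t i : Measure (E d))|
      ≤ ℓ * (h * (C * L * (D + 2 * δ))) := by
    refine abs_integral_sub_integral_le (lipschitzWith_smooth hl1 (hsm hb)).continuous
      (hm.hasCompactSupport hl1 (hsm hb)) (lipschitzWith_smooth hl2 (hsm hb')).continuous
      (hm.hasCompactSupport hl2 (hsm hb')) fun x => ?_
    refine abs_smooth_sub_smooth_le hl1.continuous (hsm hb) hl2.continuous (hsm hb')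
      (.of_forall fun z => ?_)
    refine (hl.norm_sub_le _ _).trans ?_
    gcongr
    rw [add_sub_add_left_eq_sub, ← smul_sub, norm_smul, Real.norm_of_nonneg hh]
    gcongr
    have := norm_velocity_sub_le hK hA hw (by positivity)
      (fun j => hc.lipClose hm.norm_le j) i (x - z)
    rwa [NNReal.coe_mul] at this
  rw [abs_le] at *
  push_cast at a1 a1' a2 a2' a3 a4
  rw [Real.coe_toNNReal _ hh] at a3
  constructor <;> nlinarith only [a1, a1', a2, a2', a3, a4]

theorem SmoothClose.of_initial (hm : IsMollifier m δ B) (hδ : 0 ≤ δ)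
    {f0 : Fin N → Measure (E d)} {g g' : ℝ → Fin N → ProbabilityMeasure (E d)}
    (hg : IsMcKeanSolution w K f0 g) (hg' : IsMcKeanSolution w K f0 g')
    (hK : LipschitzWith L K) (hA : ∀ x, ‖K x‖ ≤ A) (hw : ∀ i, ∑ j, |w i j| ≤ C)
    {T : ℝ} (hT : 0 ≤ T) :
    SmoothClose m (g T) (g' T) (T * (4 * (C * L) * δ) * Real.exp (T * (2 * (C * L)))) := by
  set c : ℝ := 2 * (2 * (C * L) * (C * A) + 2 * B * (C * A) ^ 2) with hc
  have hc0 : 0 ≤ c := by positivity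
  -- Discrete Grönwall on the times `k h`, with `1 + a ≤ exp a`.
  have grid : ∀ h : ℝ, 0 ≤ h → ∀ k : ℕ, SmoothClose m (g (k * h)) (g' (k * h))
      (k * (h * (4 * (C * L) * δ) + h ^ 2 * c) * Real.exp (k * (h * (2 * (C * L))))) := by
    intro h hh k
    induction k with
    | zero =>
      intro i θ ℓ _ _
      have : (g 0 i : Measure (E d)) = g' 0 i := (hg.initial i).trans (hg'.initial i).symm
      simp [this]
    | succ k ih =>
      have h1 := ih.step hm hδ hg hg' hK hA hw (by positivity) hh (by positivity)
      rw [show (k : ℝ) * h + h = (k + 1 : ℕ) * h by push_cast; ring] at h1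
      intro i θ ℓ hl hs
      refine (h1 i θ ℓ hl hs).trans ?_
      gcongr
      set a : ℝ := h * (2 * (C * L)) with ha
      set b : ℝ := h * (4 * (C * L) * δ) + h ^ 2 * c with hb
      have ha0 : 0 ≤ a := by positivity
      have hb0 : 0 ≤ b := by positivity
      have e1 : 1 + a ≤ Real.exp a := by linarith [Real.add_one_le_exp a]
      have e2 : Real.exp ((k + 1 : ℕ) * a) = Real.exp (k * a) * Real.exp a := by
        rw [← Real.exp_add]; push_cast; ring_nf
      have e3 : 1 ≤ Real.exp ((k + 1 : ℕ) * a) := Real.one_le_exp (by positivity)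
      calc (1 + a) * (k * b * Real.exp (k * a)) + b
          ≤ Real.exp a * (k * b * Real.exp (k * a)) + b * Real.exp ((k + 1 : ℕ) * a) := by
            gcongr
            exact le_mul_of_one_le_right hb0 e3
        _ = ((k + 1 : ℕ) : ℝ) * b * Real.exp ((k + 1 : ℕ) * a) := by
            rw [e2]; push_cast; ring
  intro i θ ℓ hl hs
  refine le_of_forall_pos_le_add_mul (c := 0) fun ε hε => ?_
  rw [zero_mul, add_zero]
  -- With step `T / (n + 1)` the accumulated second-order error is `T^2 c / (n + 1)`. It vanishes
  -- for fixed `δ`, although `c` contains the constant `B` of the mollifier.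
  have hlim : Tendsto (fun n : ℕ => ℓ * ((T * (4 * (C * L) * δ) + T ^ 2 * c / ((n : ℝ) + 1)) *
      Real.exp (T * (2 * (C * L))))) atTop
      (𝓝 (ℓ * ((T * (4 * (C * L) * δ) + 0) * Real.exp (T * (2 * (C * L)))))) :=
    ((tendsto_const_nhds.add (tendsto_const_nhds.div_atTop
      (tendsto_natCast_atTop_atTop.atTop_add tendsto_const_nhds))).mul_const _).const_mul _
  rw [add_zero] at hlim
  refine ge_of_tendsto' hlim fun n => ?_
  have hn : ((n : ℝ) + 1) ≠ 0 := by positivity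
  have h1 := grid (T / (n + 1)) (by positivity) (n + 1) i θ ℓ hl hs
  push_cast at h1
  rw [mul_div_cancel₀ _ hn] at h1
  refine h1.trans_eq ?_
  have e1 : ((n : ℝ) + 1) * (T / (n + 1) * (2 * (C * L))) = T * (2 * (C * L)) := by
    field_simp
  rw [e1]
  congr 2
  field_simp

end Step

theorem IsMcKeanSolution.unique {f0 : Fin N → Measure (E d)}
    {g g' : ℝ → Fin N → ProbabilityMeasure (E d)}
    (hg : IsMcKeanSolution w K f0 g) (hg' : IsMcKeanSolution w K f0 g')
    (hK : LipschitzWith L K) (hA : ∀ x, ‖K x‖ ≤ A) (hw : ∀ i, ∑ j, |w i j| ≤ C)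
    {t : ℝ} (ht : 0 ≤ t) : g t = g' t := by
  funext i
  refine LipClose.eq fun θ ℓ hl hs => ?_
  -- Now `δ → 0`. The final `2` in the slope is the cost `2 δ` of removing the mollifier.
  refine le_of_forall_pos_le_add_mul
    (c := ℓ * (t * (4 * (C * L)) * Real.exp (t * (2 * (C * L))) + 2)) fun δ hδ => ?_
  obtain ⟨m, B, hm, hB⟩ := exists_mollifier d hδ
  have := (SmoothClose.of_initial hB hδ.le hg hg' hK hA hw ht).lipClose hB.norm_le i θ ℓ hl hs
  refine this.trans_eq ?_
  ring

end PropIndep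

end

noncomputable section

namespace PropIndep

open Filter Topology

/-! ### Existence of weak solutions -/

/-- Global solvability of an autonomous equation with bounded Lipschitz right-hand side. -/
theorem exists_hasDerivAt_of_lipschitzWith {F : Type*} [NormedAddCommGroup F] [NormedSpace ℝ F]
    [CompleteSpace F] {v : F → F} {k M : ℝ≥0} (hv : LipschitzWith k v) (hM : ∀ x, ‖v x‖ ≤ M)
    (x₀ : F) : ∃ Y : ℝ → F, Y 0 = x₀ ∧ ∀ t, HasDerivAt Y (v (Y t)) t := by
  have loc : ∀ n : ℕ, ∃ α : ℝ → F, α 0 = x₀ ∧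
      ∀ t ∈ Ioo (-((n : ℝ) + 1)) (n + 1), HasDerivAt α (v (α t)) t := by
    intro n
    have h0 : (0 : ℝ) ∈ Icc (-((n : ℝ) + 1)) (n + 1) := ⟨by linarith, by positivity⟩
    -- As `v` is bounded by `M` everywhere, a ball of radius `M (n + 1)` contains the solution
    -- during the whole time interval, so the existence time is not restricted.
    have hPL : IsPicardLindelof (fun _ : ℝ => v) (⟨0, h0⟩ : Icc (-((n : ℝ) + 1)) (n + 1)) x₀
        (M * (n + 1)) 0 M k :=
      { lipschitzOnWith := fun t _ => hv.lipschitzOnWith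
        continuousOn := fun x _ => continuousOn_const
        norm_le := fun t _ x _ => hM x
        mul_max_le := by simp }
    obtain ⟨α, h1, h2⟩ := hPL.exists_eq_forall_mem_Icc_hasDerivWithinAt₀
    exact ⟨α, h1, fun t ht => (h2 t (Ioo_subset_Icc_self ht)).hasDerivAt (Icc_mem_nhds ht.1 ht.2)⟩
  choose α hα0 hα using loc
  have agree : ∀ m n : ℕ, m ≤ n → ∀ t ∈ Ioo (-((m : ℝ) + 1)) (m + 1), α m t = α n t := by
    intro m n hmn
    have hmn' : (m : ℝ) ≤ n := by exact_mod_cast hmn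
    refine ODE_solution_unique_of_mem_Ioo (v := fun _ => v) (s := fun _ => univ) (K := k) (t₀ := 0)
      (fun t _ => hv.lipschitzOnWith) ⟨by linarith, by positivity⟩
      (fun t ht => ⟨hα m t ht, mem_univ _⟩)
      (fun t ht => ⟨hα n t ⟨by linarith [ht.1], by linarith [ht.2]⟩, mem_univ _⟩)
      ((hα0 m).trans (hα0 n).symm)
  -- The local solutions agree on common intervals. The one of index `⌈|t|⌉₊` lives on an open
  -- interval around `t`, so the glued function can be differentiated at `t`.
  have hY : ∀ (n : ℕ) (t : ℝ), t ∈ Ioo (-((n : ℝ) + 1)) (n + 1) → α ⌈|t|⌉₊ t = α n t := by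
    intro n t ht
    have h1 : |t| ≤ ⌈|t|⌉₊ := Nat.le_ceil _
    rw [abs_le] at h1
    rcases le_total ⌈|t|⌉₊ n with h | h
    · exact agree _ _ h t ⟨by linarith, by linarith⟩
    · exact (agree _ _ h t ht).symm
  refine ⟨fun t => α ⌈|t|⌉₊ t, hα0 _, fun t => ?_⟩
  have h1 : |t| ≤ ⌈|t|⌉₊ := Nat.le_ceil _
  rw [abs_le] at h1
  have ht : t ∈ Ioo (-((⌈|t|⌉₊ : ℝ) + 1)) (⌈|t|⌉₊ + 1) := ⟨by linarith, by linarith⟩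
  refine (hα ⌈|t|⌉₊ t ht).congr_of_eventuallyEq ?_
  filter_upwards [Ioo_mem_nhds ht.1 ht.2] with s hs using hY _ s hs

variable {d N : ℕ} {w : Fin N → Fin N → ℝ} {K : E d → E d} {L C A : ℝ≥0}

/-- The law of `x + Y_j(x)` when `x` is distributed according to `μ_j`. -/
def displacedLaw (μ : Fin N → ProbabilityMeasure (E d))
    (Y : Fin N → BoundedContinuousFunction (E d) (E d)) (j : Fin N) : ProbabilityMeasure (E d) :=
  (μ j).map (f := fun x => x + Y j x) (by fun_prop)

/-- Both laws are images of the same `μ j`; moving each `x + Y j x` to `x + Z j x` costs at most the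
sup distance. -/
theorem lipClose_displacedLaw (μ : Fin N → ProbabilityMeasure (E d))
    (Y Z : Fin N → BoundedContinuousFunction (E d) (E d)) (j : Fin N) :
    LipClose (displacedLaw μ Y j : Measure (E d)) (displacedLaw μ Z j : Measure (E d))
      (dist Y Z) := by
  intro θ ℓ hl hs
  obtain ⟨B, hB⟩ := hs.exists_bound_of_continuous hl.continuous
  have hc := hl.continuous
  have e : ∀ W : Fin N → BoundedContinuousFunction (E d) (E d),
      ∫ x, θ x ∂(displacedLaw μ W j : Measure (E d)) = ∫ x, θ (x + W j x) ∂(μ j : Measure (E d)) :=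
    fun W => integral_map (by fun_prop) hc.measurable.aestronglyMeasurable
  rw [e, e, ← integral_sub (integrable_of_bound _ (by fun_prop) fun x => hB _)
    (integrable_of_bound _ (by fun_prop) fun x => hB _)]
  have : ∀ x, ‖θ (x + Y j x) - θ (x + Z j x)‖ ≤ ℓ * dist Y Z := fun x => by
    refine (hl.norm_sub_le _ _).trans ?_
    gcongr
    rw [add_sub_add_left_eq_sub, ← dist_eq_norm]
    exact (BoundedContinuousFunction.dist_coe_le_dist x).trans (dist_le_pi_dist Y Z j)
  simpa using norm_integral_le_of_norm_le_const (μ := (μ j : Measure (E d))) (.of_forall this)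

/-- A flow whose velocity is created by the image measures of `μ`. -/
structure IsMcKeanFlow (w : Fin N → Fin N → ℝ) (K : E d → E d)
    (μ : Fin N → ProbabilityMeasure (E d)) (Φ : ℝ → Fin N → E d → E d)
    (f : ℝ → Fin N → ProbabilityMeasure (E d)) : Prop where
  continuous : ∀ i, Continuous fun p : ℝ × E d => Φ p.1 i p.2
  zero : ∀ i x, Φ 0 i x = x
  law : ∀ t i, (f t i : Measure (E d)) = (μ i : Measure (E d)).map (Φ t i)
  hasDerivAt : ∀ t i x, HasDerivAt (fun s => Φ s i x) (velocity w K (f t) i (Φ t i x)) t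

/-- The unknown is the displacement `Φ_t^i(x) - x`, which stays bounded because the velocity is. The
laws are functions of the displacement, so the right-hand side `F` is autonomous. Its Lipschitz
constant is `2 C L`: one `C L` from the point where the velocity is evaluated, one from the laws
that create it. -/
theorem exists_mcKeanFlow (hK : LipschitzWith L K) (hA : ∀ x, ‖K x‖ ≤ A)
    (hw : ∀ i, ∑ j, |w i j| ≤ C) (μ : Fin N → ProbabilityMeasure (E d)) :
    ∃ Φ f, IsMcKeanFlow w K μ Φ f := by
  let F : (Fin N → BoundedContinuousFunction (E d) (E d)) →
      (Fin N → BoundedContinuousFunction (E d) (E d)) := fun Y i =>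
    BoundedContinuousFunction.ofNormedAddCommGroup
      (fun x => velocity w K (displacedLaw μ Y) i (x + Y i x))
      ((lipschitzWith_velocity hK hA hw _ i).continuous.comp (by fun_prop)) (C * A)
      fun x => norm_velocity_le hA hw _ i _
  have hFb : ∀ Y, ‖F Y‖ ≤ (C * A : ℝ≥0) := fun Y => by
    refine (pi_norm_le_iff_of_nonneg (by positivity)).2 fun i => ?_
    refine (BoundedContinuousFunction.norm_le (by positivity)).2 fun x => ?_
    exact norm_velocity_le hA hw _ i _
  have hFl : LipschitzWith (2 * (C * L)) F := by
    refine LipschitzWith.of_dist_le_mul fun Y Z => ?_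
    refine (dist_pi_le_iff (by positivity)).2 fun i => ?_
    refine (BoundedContinuousFunction.dist_le (by positivity)).2 fun x => ?_
    change dist (velocity w K (displacedLaw μ Y) i (x + Y i x))
      (velocity w K (displacedLaw μ Z) i (x + Z i x)) ≤ _
    refine (dist_triangle _ (velocity w K (displacedLaw μ Y) i (x + Z i x)) _).trans ?_
    have h1 := (lipschitzWith_velocity hK hA hw (displacedLaw μ Y) i).dist_le_mul (x + Y i x)
      (x + Z i x)
    rw [dist_add_left] at h1
    have h2 : dist (Y i x) (Z i x) ≤ dist Y Z :=
      (BoundedContinuousFunction.dist_coe_le_dist x).trans (dist_le_pi_dist Y Z i)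
    have h3 := norm_velocity_sub_le hK hA hw dist_nonneg (lipClose_displacedLaw μ Y Z) i (x + Z i x)
    rw [← dist_eq_norm] at h3
    have h4 := mul_le_mul_of_nonneg_left h2 (show (0 : ℝ) ≤ C * L by positivity)
    push_cast at *
    linarith
  obtain ⟨Y, hY0, hY⟩ := exists_hasDerivAt_of_lipschitzWith hFl hFb 0
  have hYc : Continuous Y := continuous_iff_continuousAt.2 fun t => (hY t).continuousAt
  refine ⟨fun t i x => x + Y t i x, fun t => displacedLaw μ (Y t), fun i => ?_, fun i x => ?_,
    fun t i => rfl, fun t i x => ?_⟩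
  · have : Continuous fun t => Y t i := (continuous_apply i).comp hYc
    fun_prop
  · simp [hY0]
  · have h1 := hasDerivAt_pi.1 (hY t) i
    have h2 := (BoundedContinuousFunction.evalCLM ℝ x).hasFDerivAt.comp_hasDerivAt t h1
    exact h2.const_add x

variable {μ : Fin N → ProbabilityMeasure (E d)} {Φ : ℝ → Fin N → E d → E d}
  {f : ℝ → Fin N → ProbabilityMeasure (E d)}

theorem IsMcKeanFlow.continuous_apply (h : IsMcKeanFlow w K μ Φ f) (t : ℝ) (i : Fin N) :
    Continuous (Φ t i) := (h.continuous i).comp (by fun_prop : Continuous fun x => (t, x))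

/-- Differentiate `∫ φ(Φ_t^i) dμ_i` under the integral sign and integrate back in time. -/
theorem IsMcKeanFlow.isMcKeanSolution (h : IsMcKeanFlow w K μ Φ f) (hK : LipschitzWith L K)
    (hA : ∀ x, ‖K x‖ ≤ A) (hw : ∀ i, ∑ j, |w i j| ≤ C) :
    IsMcKeanSolution w K (fun i => (μ i : Measure (E d))) f := by
  have hint : ∀ t i (φ : E d → ℝ), Continuous φ →
      ∫ x, φ x ∂(f t i : Measure (E d)) = ∫ x, φ (Φ t i x) ∂(μ i : Measure (E d)) := by
    intro t i φ hφ
    rw [h.law, integral_map (h.continuous_apply t i).measurable.aemeasurable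
      hφ.measurable.aestronglyMeasurable]
  have hΦt : ∀ i x, Continuous fun t => Φ t i x := fun i x =>
    (h.continuous i).comp (by fun_prop : Continuous fun t => (t, x))
  refine ⟨fun i => Continuous.continuousOn ?_, fun i => ?_, fun i φ hφ hs t ht => ?_⟩
  · refine continuous_iff_continuousAt.2 fun t => ?_
    refine ProbabilityMeasure.tendsto_iff_forall_integral_tendsto.2 fun φ => ?_
    simp_rw [hint _ i φ φ.continuous]
    have : Continuous fun s => ∫ x, φ (Φ s i x) ∂(μ i : Measure (E d)) := by
      refine continuous_of_dominated (bound := fun _ => ‖φ‖) (fun s => ?_)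
        (fun s => .of_forall fun x => φ.norm_coe_le_norm _) (integrable_const _)
        (.of_forall fun x => φ.continuous.comp (hΦt i x))
      exact (φ.continuous.comp (h.continuous_apply s i)).measurable.aestronglyMeasurable
    exact this.tendsto t
  · rw [h.law, show Φ 0 i = id from funext (h.zero i), Measure.map_id]
  · have hφc := hφ.continuous
    have hc := hφ.continuous_fderiv (by simp)
    obtain ⟨B, hB⟩ := (hs.fderiv ℝ).exists_bound_of_continuous hc
    obtain ⟨M, hM⟩ := hs.exists_bound_of_continuous hφc
    have hB0 : 0 ≤ B := (norm_nonneg _).trans (hB 0)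
    have hvc := fun s => (lipschitzWith_velocity hK hA hw (f s) i).continuous
    have hb : ∀ s x, ‖fderiv ℝ φ x (velocity w K (f s) i x)‖ ≤ B * (C * A) := fun s x =>
      (ContinuousLinearMap.le_opNorm _ _).trans
        (mul_le_mul (hB _) (norm_velocity_le hA hw _ _ _) (norm_nonneg _) hB0)
    have hder : ∀ s, HasDerivAt (fun s => ∫ x, φ (Φ s i x) ∂(μ i : Measure (E d)))
        (∫ x, fderiv ℝ φ x (velocity w K (f s) i x) ∂(f s i : Measure (E d))) s := by
      intro s
      rw [hint s i _ (hc.clm_apply (hvc s))]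
      refine (hasDerivAt_integral_of_dominated_loc_of_deriv_le (s := univ)
        (F' := fun s x => fderiv ℝ φ (Φ s i x) (velocity w K (f s) i (Φ s i x)))
        (bound := fun _ => B * (C * A)) Filter.univ_mem (.of_forall fun r => ?_) ?_ ?_
        (.of_forall fun x r _ => hb r _) (integrable_const _) (.of_forall fun x r _ => ?_)).2
      · exact (hφc.comp (h.continuous_apply r i)).measurable.aestronglyMeasurable
      · exact integrable_of_bound _ (hφc.comp (h.continuous_apply s i)) fun x => hM _
      · exact ((hc.clm_apply (hvc s)).comp (h.continuous_apply s i)).measurable.aestronglyMeasurable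
      · exact ((hφ.differentiable (by simp)) (Φ r i x)).hasFDerivAt.comp_hasDerivAt r
          (h.hasDerivAt r i x)
    -- A derivative is measurable and this one is bounded, so integrability in time needs no
    -- continuity of the velocity in time.
    have hq : (fun s => ∫ x, fderiv ℝ φ x (velocity w K (f s) i x) ∂(f s i : Measure (E d))) =
        deriv (fun s => ∫ x, φ (Φ s i x) ∂(μ i : Measure (E d))) :=
      funext fun s => (hder s).deriv.symm
    have hI : IntervalIntegrable (fun s => ∫ x, fderiv ℝ φ x (velocity w K (f s) i x)
        ∂(f s i : Measure (E d))) volume 0 t := by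
      rw [intervalIntegrable_iff, uIoc_of_le ht]
      refine Integrable.of_bound (C := B * (C * A)) ?_ (.of_forall fun s => ?_)
      · rw [hq]
        exact (measurable_deriv _).aestronglyMeasurable
      · simpa using norm_integral_le_of_norm_le_const (μ := (f s i : Measure (E d)))
          (.of_forall (hb s))
    rw [intervalIntegral.integral_eq_sub_of_hasDerivAt (fun s _ => hder s) hI, hint t i φ hφc,
      hint 0 i φ hφc]
    ring

end PropIndep

end

noncomputable section

namespace PropIndep

open Filter Topology

/-! ### Couplings that respect a finite partition -/

/-- Covers the degenerate case `M = 0`, in which `M⁻¹ = ⊤` but `η` vanishes. -/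
theorem inv_mul_smul_eq {α : Type*} [MeasurableSpace α] {η : Measure α} {M : ℝ≥0∞} (hM : M ≠ ⊤)
    (h : η univ = M) : (M⁻¹ * M) • η = η := by
  by_cases h0 : M = 0
  · rw [Measure.measure_univ_eq_zero.1 (h.trans h0), smul_zero]
  · rw [ENNReal.inv_mul_cancel h0 hM, one_smul]

section Coupling

variable {α β S : Type*} [MeasurableSpace α] [MeasurableSpace β] [MeasurableSpace S]
  [Fintype S] [MeasurableSingletonClass S]

theorem sum_restrict_fiber (μ : Measure α) {p : α → S} (hp : Measurable p) :
    ∑ s, μ.restrict (p ⁻¹' {s}) = μ := by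
  ext A hA
  rw [Measure.finsetSum_apply]
  have h := sum_measure_preimage_singleton (μ := μ.restrict A) Finset.univ
    fun s _ => hp (measurableSet_singleton s)
  simp only [Finset.coe_univ, preimage_univ, Measure.restrict_apply_univ] at h
  rw [← h]
  refine Finset.sum_congr rfl fun s _ => ?_
  rw [Measure.restrict_apply hA, Measure.restrict_apply (hp (measurableSet_singleton s)), inter_comm]

/-- A maximal coupling of the labels. In each cell `s` the common mass `min (a s) (b s)` is coupled
by a multiple of the product of the restrictions, which keeps the labels equal. What remains of `μ`
and `ν` has the same mass `M = ∑ (a s - b s)^+` on both sides, and the remainders are coupled by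
their normalized product. Only this second part can produce different labels. -/
theorem exists_coupling (μ : Measure α) (ν : Measure β) [IsProbabilityMeasure μ]
    [IsProbabilityMeasure ν] {p : α → S} {q : β → S} (hp : Measurable p) (hq : Measurable q) :
    ∃ π : Measure (α × β), π.map Prod.fst = μ ∧ π.map Prod.snd = ν ∧
      π {z | p z.1 ≠ q z.2} ≤ ∑ s, (μ (p ⁻¹' {s}) - ν (q ⁻¹' {s})) := by
  set a : S → ℝ≥0∞ := fun s => μ (p ⁻¹' {s}) with ha
  set b : S → ℝ≥0∞ := fun s => ν (q ⁻¹' {s}) with hb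
  set m : S → ℝ≥0∞ := fun s => min (a s) (b s) with hm
  have hat : ∀ s, a s ≠ ⊤ := fun s => measure_ne_top _ _
  have hbt : ∀ s, b s ≠ ⊤ := fun s => measure_ne_top _ _
  have hmt : ∀ s, m s ≠ ⊤ := fun s => ne_top_of_le_ne_top (hat s) (min_le_left _ _)
  -- Empty cells are harmless: `a s = 0` forces `m s = 0`.
  have hma : ∀ s, m s / a s * a s = m s := fun s =>
    ENNReal.div_mul_cancel' (fun h => le_antisymm ((min_le_left _ _).trans h.le) zero_le) (fun h => absurd h (hat s))
  have hmb : ∀ s, m s / b s * b s = m s := fun s =>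
    ENNReal.div_mul_cancel' (fun h => le_antisymm ((min_le_right _ _).trans h.le) zero_le) (fun h => absurd h (hbt s))
  have hma1 : ∀ s, m s / a s ≤ 1 := fun s => ENNReal.div_le_of_le_mul (by simp [hm])
  have hmb1 : ∀ s, m s / b s ≤ 1 := fun s => ENNReal.div_le_of_le_mul (by simp [hm])
  have hcb : ∀ s, m s / a s / b s * b s = m s / a s := fun s =>
    ENNReal.div_mul_cancel' (fun h => by
      rw [show m s = 0 from le_antisymm ((min_le_right _ _).trans h.le) zero_le, ENNReal.zero_div])
      (fun h => absurd h (hbt s))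
  have hca : ∀ s, m s / a s / b s * a s = m s / b s := fun s => by
    rw [div_eq_mul_inv, mul_right_comm, hma, div_eq_mul_inv]
  have suma : ∑ s, a s = 1 := by
    rw [ha, sum_measure_preimage_singleton Finset.univ fun s _ => hp (measurableSet_singleton s)]
    simp
  have sumb : ∑ s, b s = 1 := by
    rw [hb, sum_measure_preimage_singleton Finset.univ fun s _ => hq (measurableSet_singleton s)]
    simp
  have sumt : ∑ s, m s ≠ ⊤ := (ENNReal.sum_lt_top.2 fun s _ => (hmt s).lt_top).ne
  set M : ℝ≥0∞ := ∑ s, (a s - m s) with hM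
  have hM1 : M + ∑ s, m s = 1 := by
    rw [hM, ← Finset.sum_add_distrib, ← suma]
    exact Finset.sum_congr rfl fun s _ => tsub_add_cancel_of_le (min_le_left _ _)
  have hM2 : ∑ s, (b s - m s) = M := by
    refine (ENNReal.add_left_inj sumt).1 ?_
    rw [hM1, ← Finset.sum_add_distrib, ← sumb]
    exact Finset.sum_congr rfl fun s _ => tsub_add_cancel_of_le (min_le_right _ _)
  have hMt : M ≠ ⊤ := ne_top_of_le_ne_top ENNReal.one_ne_top (hM1 ▸ le_self_add)
  set μ' : Measure α := ∑ s, (1 - m s / a s) • μ.restrict (p ⁻¹' {s}) with hμ'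
  set ν' : Measure β := ∑ s, (1 - m s / b s) • ν.restrict (q ⁻¹' {s}) with hν'
  have hμu : μ' univ = M := by
    rw [hμ', hM, Measure.finsetSum_apply]
    refine Finset.sum_congr rfl fun s _ => ?_
    rw [Measure.smul_apply, Measure.restrict_apply_univ, smul_eq_mul,
      ENNReal.sub_mul (fun _ _ => hat s), one_mul]
    exact congrArg _ (hma s)
  have hνu : ν' univ = M := by
    rw [hν', ← hM2, Measure.finsetSum_apply]
    refine Finset.sum_congr rfl fun s _ => ?_
    rw [Measure.smul_apply, Measure.restrict_apply_univ, smul_eq_mul,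
      ENNReal.sub_mul (fun _ _ => hbt s), one_mul]
    exact congrArg _ (hmb s)
  have : IsFiniteMeasure μ' := ⟨hμu ▸ hMt.lt_top⟩
  have : IsFiniteMeasure ν' := ⟨hνu ▸ hMt.lt_top⟩
  -- The factor `m / (a b)` gives the cell product total mass `m` and marginals `(m / a) μ` and `(m
  -- / b) ν` restricted to the cell. Those of the second term are `μ'` and `ν'`, which complete
  -- them.
  refine ⟨(∑ s, (m s / a s / b s) • (μ.restrict (p ⁻¹' {s})).prod (ν.restrict (q ⁻¹' {s})))
    + M⁻¹ • μ'.prod ν', ?_, ?_, ?_⟩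
  · rw [Measure.map_add _ _ measurable_fst, Measure.map_smul, Measure.map_fst_prod, hνu, smul_smul,
      inv_mul_smul_eq hMt hμu, ← Measure.mapₗ_apply_of_measurable measurable_fst, map_sum, hμ',
      ← Finset.sum_add_distrib]
    conv_rhs => rw [← sum_restrict_fiber μ hp]
    refine Finset.sum_congr rfl fun s _ => ?_
    rw [Measure.mapₗ_apply_of_measurable measurable_fst, Measure.map_smul, Measure.map_fst_prod,
      Measure.restrict_apply_univ, smul_smul, ← add_smul]
    change (m s / a s / b s * b s + (1 - m s / a s)) • _ = _
    rw [hcb, add_tsub_cancel_of_le (hma1 s), one_smul]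
  · rw [Measure.map_add _ _ measurable_snd, Measure.map_smul, Measure.map_snd_prod, hμu, smul_smul,
      inv_mul_smul_eq hMt hνu, ← Measure.mapₗ_apply_of_measurable measurable_snd, map_sum, hν',
      ← Finset.sum_add_distrib]
    conv_rhs => rw [← sum_restrict_fiber ν hq]
    refine Finset.sum_congr rfl fun s _ => ?_
    rw [Measure.mapₗ_apply_of_measurable measurable_snd, Measure.map_smul, Measure.map_snd_prod,
      Measure.restrict_apply_univ, smul_smul, ← add_smul]
    change (m s / a s / b s * a s + (1 - m s / b s)) • _ = _
    rw [hca, add_tsub_cancel_of_le (hmb1 s), one_smul]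
  · rw [Measure.add_apply, Measure.finsetSum_apply]
    have h0 : ∀ s, ((m s / a s / b s) • (μ.restrict (p ⁻¹' {s})).prod (ν.restrict (q ⁻¹' {s})))
        {z | p z.1 ≠ q z.2} = 0 := fun s => by
      rw [Measure.smul_apply, Measure.prod_restrict, Measure.restrict_apply'
        ((hp (measurableSet_singleton s)).prod (hq (measurableSet_singleton s)))]
      convert smul_zero _
      convert measure_empty (μ := μ.prod ν)
      ext z
      simp only [mem_inter_iff, mem_ofPred_eq, mem_prod, mem_preimage, mem_singleton_iff,
        mem_empty_iff_false, iff_false]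
      rintro ⟨h1, h2, h3⟩
      exact h1 (h2.trans h3.symm)
    rw [Finset.sum_eq_zero fun s _ => h0 s, zero_add, Measure.smul_apply]
    have hsub : ∀ s, a s - m s = a s - b s := fun s => by
      rcases le_total (a s) (b s) with h | h
      · rw [tsub_eq_zero_of_le h]
        simp [hm, h]
      · simp [hm, h]
    calc M⁻¹ • (μ'.prod ν') {z | p z.1 ≠ q z.2} ≤ M⁻¹ • (μ'.prod ν') univ := by
          gcongr
          exact subset_univ _
      _ = M⁻¹ * M * M := by
          rw [← univ_prod_univ, Measure.prod_prod, hμu, hνu, smul_eq_mul, mul_assoc]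
      _ ≤ 1 * M := by gcongr; exact ENNReal.inv_mul_le_one M
      _ = _ := by rw [one_mul, hM]; exact Finset.sum_congr rfl fun s _ => hsub s

end Coupling

/-! ### A grid in `ℝ^d` -/

theorem norm_le_sqrt_mul {d : ℕ} {x : E d} {r : ℝ} (hr : 0 ≤ r) (h : ∀ k, |x k| ≤ r) :
    ‖x‖ ≤ √d * r := by
  rw [EuclideanSpace.norm_eq]
  calc √(∑ i, ‖x i‖ ^ 2) ≤ √(∑ _i : Fin d, r ^ 2) := by
        gcongr with i
        exact h i
    _ = √d * r := by
        rw [Finset.sum_const, Finset.card_univ, Fintype.card_fin, nsmul_eq_mul,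
          Real.sqrt_mul (by positivity), Real.sqrt_sq hr]

/-- The index of the cell of `[-R, R]`, divided into `n` cells, that contains `x`. -/
def cellIndex (R : ℝ) (n : ℕ) [NeZero n] (x : ℝ) : Fin n :=
  Fin.ofNat n (min ⌊(x + R) / (2 * R / n)⌋₊ (n - 1))

theorem cellIndex_val (R : ℝ) (n : ℕ) [NeZero n] (x : ℝ) :
    (cellIndex R n x : ℕ) = min ⌊(x + R) / (2 * R / n)⌋₊ (n - 1) := by
  have : 0 < n := Nat.pos_of_ne_zero (NeZero.ne n)
  rw [cellIndex, Fin.val_ofNat, Nat.mod_eq_of_lt]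
  omega

theorem measurable_cellIndex (R : ℝ) (n : ℕ) [NeZero n] : Measurable (cellIndex R n) :=
  (measurable_from_top (f := fun k : ℕ => Fin.ofNat n (min k (n - 1)))).comp
    (Nat.measurable_floor.comp (by fun_prop))

theorem abs_sub_cell_le {R : ℝ} (hR : 0 < R) (n : ℕ) [NeZero n] {x : ℝ} (hx : |x| ≤ R) :
    |x - (-R + (cellIndex R n x : ℕ) * (2 * R / n))| ≤ 2 * R / n := by
  have hn0 : 0 < n := Nat.pos_of_ne_zero (NeZero.ne n)
  have hn : (0 : ℝ) < n := by exact_mod_cast hn0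
  set ε := 2 * R / n with hε
  have hε0 : 0 < ε := by positivity
  have hnε : n * ε = 2 * R := by rw [hε]; field_simp
  rw [abs_le] at hx
  have h0 : 0 ≤ (x + R) / ε := div_nonneg (by linarith) hε0.le
  have h1 := Nat.floor_le h0
  have h2 := Nat.lt_floor_add_one ((x + R) / ε)
  rw [le_div_iff₀ hε0] at h1
  rw [div_lt_iff₀ hε0] at h2
  rw [cellIndex_val, ← hε, abs_le]
  rcases le_total ⌊(x + R) / ε⌋₊ (n - 1) with h | h
  · rw [min_eq_left h]
    constructor <;> nlinarith
  -- The cap at `n - 1` puts the right endpoint `x = R`, whose floor is `n`, into the last cell.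
  · rw [min_eq_right h]
    have h3 : ((n - 1 : ℕ) : ℝ) ≤ ⌊(x + R) / ε⌋₊ := by exact_mod_cast h
    have h4 := mul_le_mul_of_nonneg_right h3 hε0.le
    rw [Nat.cast_sub hn0, Nat.cast_one] at h4 ⊢
    constructor <;> nlinarith

/-- Inside the ball of radius `R` the error is the cell diameter. Outside, it is at most `(1 + √d)
‖x‖ ≤ (1 + √d) ‖x‖^2 / R`. The sum of both bounds holds everywhere and is integrable under a second
moment. -/
theorem exists_grid (d n : ℕ) (hn : 0 < n) {R : ℝ} (hR : 0 < R) :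
    ∃ (T : E d → (Fin d → Fin n)) (c : (Fin d → Fin n) → E d), Measurable T ∧
      (∀ s, ‖c s‖ ≤ √d * R) ∧
      ∀ x, ‖x - c (T x)‖ ≤ √d * (2 * R / n) + (1 + √d) / R * ‖x‖ ^ 2 := by
  have : NeZero n := ⟨hn.ne'⟩
  have hn' : (0 : ℝ) < n := by exact_mod_cast hn
  set T : E d → (Fin d → Fin n) := fun x k => cellIndex R n (x k) with hT
  set c : (Fin d → Fin n) → E d :=
    fun s => WithLp.toLp 2 fun k => -R + (s k : ℕ) * (2 * R / n) with hc
  have hcs : ∀ s, ‖c s‖ ≤ √d * R := fun s => by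
    refine norm_le_sqrt_mul hR.le fun k => ?_
    have h1 : ((s k : ℕ) : ℝ) ≤ n := by exact_mod_cast (s k).2.le
    have h2 : ((s k : ℕ) : ℝ) * (2 * R / n) ≤ n * (2 * R / n) := by gcongr
    have h3 : (n : ℝ) * (2 * R / n) = 2 * R := by field_simp
    have h4 : 0 ≤ ((s k : ℕ) : ℝ) * (2 * R / n) := by positivity
    simp only [hc, abs_le]
    constructor <;> linarith
  refine ⟨T, c, ?_, hcs, fun x => ?_⟩
  · exact measurable_pi_lambda _ fun k => (measurable_cellIndex R n).comp (by fun_prop)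
  · rcases le_total ‖x‖ R with h | h
    · have h1 : ‖x - c (T x)‖ ≤ √d * (2 * R / n) :=
        norm_le_sqrt_mul (by positivity) fun k =>
          abs_sub_cell_le hR n ((PiLp.norm_apply_le x k).trans h)
      have : 0 ≤ (1 + √d) / R * ‖x‖ ^ 2 := by positivity
      linarith
    · have h1 := (norm_sub_le x (c (T x))).trans (add_le_add_right (hcs _) _)
      have h2 : ‖x‖ + √d * R ≤ (1 + √d) * ‖x‖ := by
        have := mul_le_mul_of_nonneg_left h (Real.sqrt_nonneg d)
        linarith
      have h3 : (1 + √d) * ‖x‖ ≤ (1 + √d) / R * ‖x‖ ^ 2 := by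
        rw [div_mul_eq_mul_div, le_div_iff₀ hR, pow_two, mul_assoc]
        gcongr
      have : 0 ≤ √d * (2 * R / n) := by positivity
      linarith

/-! ### Empirical measures of independent variables -/

section Empirical

variable {d N : ℕ}

/-- The uniform probability measure on `Fin N`. -/
def uniformFin (N : ℕ) : Measure (Fin N) := (N : ℝ≥0∞)⁻¹ • ∑ i, Measure.dirac i

theorem map_uniformFin (x : Fin N → E d) : (uniformFin N).map x = empiricalMeasure x := by
  have hx : Measurable x := measurable_of_finite x
  rw [uniformFin, Measure.map_smul, ← Measure.mapₗ_apply_of_measurable hx, map_sum,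
    empiricalMeasure, avgMeasure]
  simp_rw [Measure.mapₗ_apply_of_measurable hx, Measure.map_dirac]

theorem lintegral_uniformFin (h : Fin N → ℝ≥0∞) :
    ∫⁻ i, h i ∂uniformFin N = (N : ℝ≥0∞)⁻¹ * ∑ i, h i := by
  rw [uniformFin, lintegral_smul_measure, lintegral_finsetSum_measure]
  simp

theorem inv_mul_sum_le_const (hN : 0 < N) {h : Fin N → ℝ≥0∞} {c : ℝ≥0∞} (hc : ∀ i, h i ≤ c) :
    (N : ℝ≥0∞)⁻¹ * ∑ i, h i ≤ c := by
  have h0 : (N : ℝ≥0∞) ≠ 0 := by exact_mod_cast hN.ne'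
  calc _ ≤ (N : ℝ≥0∞)⁻¹ * ∑ _i : Fin N, c := by gcongr with i; exact hc i
    _ = c := by
      rw [Finset.sum_const, Finset.card_univ, Fintype.card_fin, nsmul_eq_mul, ← mul_assoc,
        ENNReal.inv_mul_cancel h0 (ENNReal.natCast_ne_top N), one_mul]

theorem isProbabilityMeasure_avgMeasure (hN : 0 < N) (f : Fin N → Measure (E d))
    [∀ i, IsProbabilityMeasure (f i)] : IsProbabilityMeasure (avgMeasure f) := by
  refine ⟨?_⟩
  rw [avgMeasure, Measure.smul_apply, Measure.finsetSum_apply]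
  simp only [measure_univ, Finset.sum_const, Finset.card_univ, Fintype.card_fin, nsmul_eq_mul,
    mul_one, smul_eq_mul]
  exact ENNReal.inv_mul_cancel (by exact_mod_cast hN.ne') (ENNReal.natCast_ne_top N)

theorem isProbabilityMeasure_uniformFin (hN : 0 < N) : IsProbabilityMeasure (uniformFin N) := by
  refine ⟨?_⟩
  rw [uniformFin, Measure.smul_apply, Measure.finsetSum_apply]
  simp only [measure_univ, Finset.sum_const, Finset.card_univ, Fintype.card_fin, nsmul_eq_mul,
    mul_one, smul_eq_mul]
  exact ENNReal.inv_mul_cancel (by exact_mod_cast hN.ne') (ENNReal.natCast_ne_top N)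

/-- Transport `x_i → y_i → c(T y_i) → c(T z) → z`, with the index `i` and the point `z` coupled so
that the cells of `y_i` and `z` agree as often as possible. The middle move costs at most `2 r`, and
only when the cells differ. In the application `x` is the true system and `y` the independent copy.
-/
theorem W1_empirical_le (hN : 0 < N) {S : Type*} [Fintype S] [MeasurableSpace S]
    [MeasurableSingletonClass S] {T : E d → S} (hT : Measurable T) {c : S → E d} {r : ℝ}
    (hc : ∀ s, ‖c s‖ ≤ r) (x y : Fin N → E d) (ν : Measure (E d)) [IsProbabilityMeasure ν] :
    W1 (empiricalMeasure x) ν ≤ (N : ℝ≥0∞)⁻¹ * ∑ i, edist (x i) (y i) +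
      (N : ℝ≥0∞)⁻¹ * ∑ i, edist (y i) (c (T (y i))) +
      ENNReal.ofReal (2 * r) * ∑ s, ((N : ℝ≥0∞)⁻¹ * ∑ i, (T ⁻¹' {s}).indicator 1 (y i) -
        ν (T ⁻¹' {s})) + ∫⁻ z, edist z (c (T z)) ∂ν := by
  have := isProbabilityMeasure_uniformFin hN
  have hx : Measurable x := measurable_of_finite x
  have hcm : Measurable c := measurable_of_finite c
  obtain ⟨π, h1, h2, h3⟩ := exists_coupling (uniformFin N) ν
    (p := fun i => T (y i)) (q := T) (measurable_of_finite _) hT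
  have hcost : W1 (empiricalMeasure x) ν ≤ ∫⁻ z, edist (x z.1) z.2 ∂π := by
    have hg : Measurable fun z : Fin N × E d => (x z.1, z.2) :=
      (hx.comp measurable_fst).prodMk measurable_snd
    have g1 : (π.map fun z => (x z.1, z.2)).map Prod.fst = empiricalMeasure x := by
      rw [Measure.map_map measurable_fst hg, ← map_uniformFin, ← h1,
        Measure.map_map hx measurable_fst]
      rfl
    have g2 : (π.map fun z => (x z.1, z.2)).map Prod.snd = ν := by
      rw [Measure.map_map measurable_snd hg, ← h2]
      rfl
    refine (iInf₂_le (π.map fun z => (x z.1, z.2)) ⟨g1, g2⟩).trans_eq ?_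
    rw [lintegral_map (measurable_fst.edist measurable_snd) hg]
  refine hcost.trans ?_
  have hset : MeasurableSet {z : Fin N × E d | T (y z.1) ≠ T z.2} :=
    (measurableSet_eq_fun ((measurable_of_finite fun i => T (y i)).comp measurable_fst)
      (hT.comp measurable_snd)).compl
  have hpt : ∀ z : Fin N × E d, edist (x z.1) z.2 ≤
      (edist (x z.1) (y z.1) + edist (y z.1) (c (T (y z.1)))) +
      (ENNReal.ofReal (2 * r) * {z : Fin N × E d | T (y z.1) ≠ T z.2}.indicator 1 z +
      edist z.2 (c (T z.2))) := by
    intro z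
    have hmid : edist (c (T (y z.1))) (c (T z.2)) ≤
        ENNReal.ofReal (2 * r) * {z : Fin N × E d | T (y z.1) ≠ T z.2}.indicator 1 z := by
      by_cases h : T (y z.1) = T z.2
      · simp [h]
      · rw [indicator_of_mem (show z ∈ {z : Fin N × E d | T (y z.1) ≠ T z.2} from h), Pi.one_apply,
          mul_one, edist_dist]
        refine ENNReal.ofReal_le_ofReal ?_
        rw [dist_eq_norm]
        exact (norm_sub_le _ _).trans (by linarith [hc (T (y z.1)), hc (T z.2)])
    calc edist (x z.1) z.2 ≤ edist (x z.1) (c (T (y z.1))) + edist (c (T (y z.1))) z.2 :=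
          edist_triangle _ _ _
      _ ≤ (edist (x z.1) (y z.1) + edist (y z.1) (c (T (y z.1)))) +
          (edist (c (T (y z.1))) (c (T z.2)) + edist (c (T z.2)) z.2) :=
          add_le_add (edist_triangle _ _ _) (edist_triangle _ _ _)
      _ ≤ _ := by
          rw [edist_comm (c (T z.2)) z.2]
          gcongr
  refine (lintegral_mono hpt).trans ?_
  have m1 : Measurable fun i : Fin N => edist (x i) (y i) + edist (y i) (c (T (y i))) :=
    measurable_of_finite _
  have m2 : Measurable fun z : E d => edist z (c (T z)) :=
    measurable_id.edist (hcm.comp hT)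
  have m1' : Measurable fun z : Fin N × E d =>
      edist (x z.1) (y z.1) + edist (y z.1) (c (T (y z.1))) := m1.comp measurable_fst
  have m2' : Measurable fun z : Fin N × E d => edist z.2 (c (T z.2)) := m2.comp measurable_snd
  rw [lintegral_add_left m1', lintegral_add_right _ m2',
    lintegral_const_mul _ (measurable_one.indicator hset), lintegral_indicator_one hset]
  have e1 : ∫⁻ z, edist (x z.1) (y z.1) + edist (y z.1) (c (T (y z.1))) ∂π =
      (N : ℝ≥0∞)⁻¹ * ∑ i, edist (x i) (y i) +
      (N : ℝ≥0∞)⁻¹ * ∑ i, edist (y i) (c (T (y i))) := by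
    rw [← lintegral_map (μ := π) m1 measurable_fst, h1, lintegral_uniformFin,
      Finset.sum_add_distrib, mul_add]
  have e2 : ∫⁻ z, edist z.2 (c (T z.2)) ∂π = ∫⁻ z, edist z (c (T z)) ∂ν := by
    rw [← lintegral_map (μ := π) m2 measurable_snd, h2]
  rw [e1, e2, ← add_assoc]
  gcongr
  refine h3.trans_eq (Finset.sum_congr rfl fun s _ => ?_)
  congr 1
  rw [uniformFin, Measure.smul_apply, Measure.finsetSum_apply, smul_eq_mul]
  congr 1
  refine Finset.sum_congr rfl fun i _ => ?_
  rw [Measure.dirac_apply]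
  simp only [indicator, Pi.one_apply]
  rfl

theorem integral_norm_le_sqrt {Ω F : Type*} [MeasurableSpace Ω] [NormedAddCommGroup F]
    {P : Measure Ω} [IsProbabilityMeasure P] {Y : Ω → F} (hY : MemLp Y 2 P) :
    ∫ ω, ‖Y ω‖ ∂P ≤ √(∫ ω, ‖Y ω‖ ^ 2 ∂P) := by
  have h := variance_nonneg (fun ω => ‖Y ω‖) P
  rw [variance_eq_sub hY.norm] at h
  refine Real.le_sqrt_of_sq_le ?_
  simpa using h

/-- Independence makes the variance of the number of visits to `A` at most `N`. Cauchy–Schwarz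
bounds its mean absolute deviation by `√N`, which also dominates the truncated difference in `ℝ≥0∞`.
-/
theorem lintegral_frequency_sub_le {Ω : Type*} [MeasurableSpace Ω] {P : Measure Ω}
    [IsProbabilityMeasure P] (hN : 0 < N) {ξ : Fin N → Ω → E d} (hξ : ∀ i, Measurable (ξ i))
    (hind : iIndepFun ξ P) {A : Set (E d)} (hA : MeasurableSet A) :
    ∫⁻ ω, ((N : ℝ≥0∞)⁻¹ * ∑ i, A.indicator 1 (ξ i ω) - avgMeasure (fun i => P.map (ξ i)) A) ∂P ≤
      ENNReal.ofReal (1 / √N) := by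
  have hN' : (0 : ℝ) < N := by exact_mod_cast hN
  let Z : Fin N → Ω → ℝ := fun i ω => A.indicator 1 (ξ i ω)
  have hZm : ∀ i, Measurable (Z i) := fun i => (measurable_one.indicator hA).comp (hξ i)
  have hZ0 : ∀ i ω, 0 ≤ Z i ω := fun i ω => indicator_nonneg (fun _ _ => zero_le_one) _
  have hZ1 : ∀ i ω, Z i ω ≤ 1 := fun i ω => indicator_le_self' (fun _ _ => zero_le_one) _
  have hZb : ∀ i ω, ‖Z i ω‖ ≤ 1 := fun i ω => by
    rw [Real.norm_of_nonneg (hZ0 i ω)]; exact hZ1 i ω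
  have hZL : ∀ i, MemLp (Z i) 2 P := fun i =>
    MemLp.of_bound (hZm i).aestronglyMeasurable 1 (.of_forall (hZb i))
  have hZI : ∀ i, Integrable (Z i) P := fun i => (hZL i).integrable (by norm_num)
  have hvar : variance (∑ i, Z i) P ≤ N := by
    rw [IndepFun.variance_sum (fun i _ => hZL i) fun i _ j _ hij =>
      (hind.indepFun hij).comp (φ := A.indicator (1 : E d → ℝ)) (ψ := A.indicator (1 : E d → ℝ))
        (measurable_one.indicator hA) (measurable_one.indicator hA)]
    calc ∑ i, variance (Z i) P ≤ ∑ _i : Fin N, (1 : ℝ) := Finset.sum_le_sum fun i _ => by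
          refine (variance_le_expectation_sq (hZm i).aestronglyMeasurable).trans ?_
          have h1 : ∫ ω, (Z i ^ 2) ω ∂P ≤ ∫ _, (1 : ℝ) ∂P := by
            refine integral_mono ((hZL i).integrable_sq) (integrable_const _) fun ω => ?_
            simp only [Pi.pow_apply]
            exact pow_le_one₀ (hZ0 i ω) (hZ1 i ω)
          simpa using h1
      _ = N := by simp
  have hsumL : MemLp (∑ i, Z i) 2 P := memLp_finsetSum' _ fun i _ => hZL i
  set e := ∫ ω, (∑ i, Z i) ω ∂P with he
  have hYL : MemLp (fun ω => (∑ i, Z i) ω - e) 2 P := hsumL.sub (memLp_const e)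
  have hY : ∫ ω, ‖(∑ i, Z i) ω - e‖ ∂P ≤ √N := by
    refine (integral_norm_le_sqrt hYL).trans (Real.sqrt_le_sqrt ?_)
    refine le_trans (le_of_eq ?_) hvar
    rw [variance_eq_integral hsumL.aestronglyMeasurable.aemeasurable]
    simp [he]
  have hpt : ∀ ω, (N : ℝ≥0∞)⁻¹ * ∑ i, A.indicator 1 (ξ i ω) -
      avgMeasure (fun i => P.map (ξ i)) A ≤ ENNReal.ofReal ((N : ℝ)⁻¹ * ‖(∑ i, Z i) ω - e‖) := by
    intro ω
    have e1 : (N : ℝ≥0∞)⁻¹ * ∑ i, A.indicator 1 (ξ i ω) =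
        ENNReal.ofReal ((N : ℝ)⁻¹ * ∑ i, Z i ω) := by
      rw [ENNReal.ofReal_mul (by positivity), ENNReal.ofReal_inv_of_pos hN', ENNReal.ofReal_natCast,
        ENNReal.ofReal_sum_of_nonneg fun i _ => hZ0 i ω]
      congr 1
      refine Finset.sum_congr rfl fun i _ => ?_
      by_cases h : ξ i ω ∈ A <;> simp [Z, h]
    have e2 : avgMeasure (fun i => P.map (ξ i)) A = ENNReal.ofReal ((N : ℝ)⁻¹ * e) := by
      have he' : e = ∑ i, P.real (ξ i ⁻¹' A) := by
        rw [he]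
        simp_rw [Finset.sum_apply]
        rw [integral_finsetSum _ fun i _ => hZI i]
        refine Finset.sum_congr rfl fun i _ => ?_
        have : Z i = (ξ i ⁻¹' A).indicator 1 := by
          ext ω; by_cases h : ξ i ω ∈ A <;> simp [Z, h]
        rw [this, integral_indicator_one (hξ i hA)]
      rw [avgMeasure, Measure.smul_apply, Measure.finsetSum_apply, he',
        ENNReal.ofReal_mul (by positivity), ENNReal.ofReal_inv_of_pos hN', ENNReal.ofReal_natCast,
        ENNReal.ofReal_sum_of_nonneg fun i _ => measureReal_nonneg, smul_eq_mul]
      congr 1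
      refine Finset.sum_congr rfl fun i _ => ?_
      rw [Measure.map_apply (hξ i) hA, ofReal_measureReal]
    have he0 : 0 ≤ e := integral_nonneg fun ω => by
      rw [Finset.sum_apply]; exact Finset.sum_nonneg fun i _ => hZ0 i ω
    rw [e1, e2, ← ENNReal.ofReal_sub _ (mul_nonneg (by positivity) he0), ← mul_sub]
    refine ENNReal.ofReal_le_ofReal ?_
    gcongr
    rw [Finset.sum_apply]
    exact le_abs_self _
  refine (lintegral_mono hpt).trans ?_
  have hint : Integrable (fun ω => (N : ℝ)⁻¹ * ‖(∑ i, Z i) ω - e‖) P :=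
    ((hYL.integrable (by norm_num)).norm).const_mul _
  rw [← ofReal_integral_eq_lintegral_ofReal hint (.of_forall fun ω => mul_nonneg (by positivity) (norm_nonneg _)),
    integral_const_mul]
  refine ENNReal.ofReal_le_ofReal ?_
  calc (N : ℝ)⁻¹ * ∫ ω, ‖(∑ i, Z i) ω - e‖ ∂P ≤ (N : ℝ)⁻¹ * √N := by gcongr
    _ = 1 / √N := by
      rw [inv_mul_eq_div, Real.sqrt_div_self, one_div]

theorem lintegral_edist_grid_le {Ω : Type*} [MeasurableSpace Ω] {P : Measure Ω}
    [IsProbabilityMeasure P] {ξ : Ω → E d} (hξ : MemLp ξ 2 P) {ρ a b : ℝ} (ha : 0 ≤ a) (hb : 0 ≤ b)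
    (hρ : ∫ ω, ‖ξ ω‖ ^ 2 ∂P ≤ ρ ^ 2) {τ : E d → E d} (hτ : ∀ x, ‖x - τ x‖ ≤ a + b * ‖x‖ ^ 2) :
    ∫⁻ ω, edist (ξ ω) (τ (ξ ω)) ∂P ≤ ENNReal.ofReal (a + b * ρ ^ 2) := by
  have hi : Integrable (fun ω => ‖ξ ω‖ ^ 2) P := hξ.norm.integrable_sq
  calc ∫⁻ ω, edist (ξ ω) (τ (ξ ω)) ∂P ≤ ∫⁻ ω, ENNReal.ofReal (a + b * ‖ξ ω‖ ^ 2) ∂P := by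
        refine lintegral_mono fun ω => ?_
        rw [edist_dist, dist_eq_norm]
        exact ENNReal.ofReal_le_ofReal (hτ _)
    _ = ENNReal.ofReal (∫ ω, (a + b * ‖ξ ω‖ ^ 2) ∂P) :=
        (ofReal_integral_eq_lintegral_ofReal ((integrable_const a).add (hi.const_mul b))
          (.of_forall fun ω => add_nonneg ha (mul_nonneg hb (sq_nonneg _)))).symm
    _ ≤ _ := by
        refine ENNReal.ofReal_le_ofReal ?_
        rw [integral_add (integrable_const a) (hi.const_mul b), integral_const_mul]
        simp only [integral_const, probReal_univ, one_smul]
        gcongr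

/-- Expectation of `W1_empirical_le`: two discretization errors controlled by second moments, and
`n^d` cells that each contribute at most `1 / √N`. -/
theorem lintegral_W1_empirical_le_of_grid {Ω : Type*} [MeasurableSpace Ω] {P : Measure Ω}
    [IsProbabilityMeasure P] (hN : 0 < N) {X ξ : Fin N → Ω → E d} (hX : ∀ i, Measurable (X i))
    (hξ : ∀ i, Measurable (ξ i)) (hind : iIndepFun ξ P) (hL : ∀ i, MemLp (ξ i) 2 P) {ρ : ℝ}
    (hρ : ∀ i, ∫ ω, ‖ξ i ω‖ ^ 2 ∂P ≤ ρ ^ 2) {n : ℕ} (hn : 0 < n) {R : ℝ} (hR : 0 < R) :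
    ∫⁻ ω, W1 (empiricalMeasure fun i => X i ω) (avgMeasure fun i => P.map (ξ i)) ∂P ≤
      (N : ℝ≥0∞)⁻¹ * ∑ i, ∫⁻ ω, edist (X i ω) (ξ i ω) ∂P +
      ENNReal.ofReal (2 * (√d * (2 * R / n) + (1 + √d) / R * ρ ^ 2) +
        2 * (√d * R) * (n ^ d * (1 / √N))) := by
  have hp : ∀ i, IsProbabilityMeasure (P.map (ξ i)) := fun i =>
    Measure.isProbabilityMeasure_map (hξ i).aemeasurable
  have := isProbabilityMeasure_avgMeasure hN fun i => P.map (ξ i)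
  obtain ⟨T, c, hT, hc, hTc⟩ := exists_grid d n hn hR
  have hcm : Measurable c := measurable_of_finite c
  have mτ : Measurable fun x => edist x (c (T x)) := measurable_id.edist (hcm.comp hT)
  set a := √d * (2 * R / n) with ha
  set b := (1 + √d) / R with hb
  have ha0 : 0 ≤ a := by positivity
  have hb0 : 0 ≤ b := by positivity
  have tail : ∀ i, ∫⁻ ω, edist (ξ i ω) (c (T (ξ i ω))) ∂P ≤ ENNReal.ofReal (a + b * ρ ^ 2) :=
    fun i => lintegral_edist_grid_le (τ := fun x => c (T x)) (hL i) ha0 hb0 (hρ i) hTc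
  have tail2 : ∫⁻ z, edist z (c (T z)) ∂(avgMeasure fun i => P.map (ξ i)) ≤
      ENNReal.ofReal (a + b * ρ ^ 2) := by
    rw [avgMeasure, lintegral_smul_measure, lintegral_finsetSum_measure, smul_eq_mul]
    refine inv_mul_sum_le_const hN fun i => ?_
    rw [lintegral_map mτ (hξ i)]
    exact tail i
  have mfreq : ∀ s, Measurable fun ω => (N : ℝ≥0∞)⁻¹ * ∑ i, (T ⁻¹' {s}).indicator 1 (ξ i ω) -
      avgMeasure (fun i => P.map (ξ i)) (T ⁻¹' {s}) := fun s => by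
    refine Measurable.sub_const (Measurable.const_mul (Finset.measurable_fun_sum _ fun i _ => ?_) _) _
    exact (measurable_one.indicator (hT (measurableSet_singleton s))).comp (hξ i)
  have m1 : Measurable fun ω => (N : ℝ≥0∞)⁻¹ * ∑ i, edist (X i ω) (ξ i ω) :=
    Measurable.const_mul (Finset.measurable_fun_sum _ fun i _ => (hX i).edist (hξ i)) _
  have m2 : Measurable fun ω => (N : ℝ≥0∞)⁻¹ * ∑ i, edist (ξ i ω) (c (T (ξ i ω))) :=
    Measurable.const_mul (Finset.measurable_fun_sum _ fun i _ => mτ.comp (hξ i)) _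
  have mξ : ∀ i, Measurable fun ω => edist (ξ i ω) (c (T (ξ i ω))) := fun i => mτ.comp (hξ i)
  have m12 : Measurable fun ω => (N : ℝ≥0∞)⁻¹ * ∑ i, edist (X i ω) (ξ i ω) +
      (N : ℝ≥0∞)⁻¹ * ∑ i, edist (ξ i ω) (c (T (ξ i ω))) := m1.add m2
  refine (lintegral_mono fun ω => W1_empirical_le hN hT hc (fun i => X i ω) (fun i => ξ i ω)
    (avgMeasure fun i => P.map (ξ i))).trans ?_
  rw [lintegral_add_right _ measurable_const, lintegral_add_left m12,
    lintegral_add_left m1, lintegral_const_mul _ (Finset.measurable_fun_sum _ fun s _ => mfreq s),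
    lintegral_finsetSum _ fun s _ => mfreq s, lintegral_const, measure_univ, mul_one,
    lintegral_const_mul _ (Finset.measurable_fun_sum _ fun i _ => (hX i).edist (hξ i)),
    lintegral_finsetSum _ fun i _ => (hX i).edist (hξ i),
    lintegral_const_mul _ (Finset.measurable_fun_sum _ fun i _ => mξ i),
    lintegral_finsetSum _ fun i _ => mξ i, add_assoc, add_assoc]
  gcongr
  have b1 := inv_mul_sum_le_const hN tail
  have b2 : ∑ s, ∫⁻ ω, ((N : ℝ≥0∞)⁻¹ * ∑ i, (T ⁻¹' {s}).indicator 1 (ξ i ω) -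
      avgMeasure (fun i => P.map (ξ i)) (T ⁻¹' {s})) ∂P ≤ ENNReal.ofReal (n ^ d * (1 / √N)) := by
    calc _ ≤ ∑ _s : Fin d → Fin n, ENNReal.ofReal (1 / √N) := Finset.sum_le_sum fun s _ =>
          lintegral_frequency_sub_le hN hξ hind (hT (measurableSet_singleton s))
      _ = _ := by
          rw [Finset.sum_const, Finset.card_univ, Fintype.card_fun, Fintype.card_fin,
            Fintype.card_fin, nsmul_eq_mul, ENNReal.ofReal_mul (by positivity)]
          congr 1
          rw [← Nat.cast_pow, ENNReal.ofReal_natCast]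
  refine (add_le_add b1 (add_le_add (mul_le_mul_right b2 _) tail2)).trans_eq ?_
  rw [← ENNReal.ofReal_mul (by positivity), ← ENNReal.ofReal_add (by positivity) (by positivity),
    ← ENNReal.ofReal_add (by positivity) (by positivity)]
  congr 1
  ring

/-- The rate of convergence of the empirical measure of `N` independent variables. -/
def rate (d : ℕ) : ℝ := 1 / (4 * (d + 1))

theorem rate_pos (d : ℕ) : 0 < rate d := by unfold rate; positivity

/-- The constant in the convergence of the empirical measure of `N` independent variables. -/
def rateConst (d : ℕ) : ℝ := 2 + 6 * √d + 2 ^ (d + 1) * √d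

theorem rateConst_pos (d : ℕ) : 0 < rateConst d := by unfold rateConst; positivity

/-- With `u = N ^ rate d` one has `√N = u^{2(d+1)}`. Taking about `u^2` cells per axis and `R = ρ
u`, each of the terms `R / n`, `ρ^2 / R` and `R n^d / √N` is of order `ρ / u`. -/
theorem grid_cost_le (d : ℕ) (hN : 0 < N) {ρ : ℝ} (hρ : 0 < ρ) :
    ∃ n : ℕ, 0 < n ∧ ∃ R : ℝ, 0 < R ∧
      2 * (√d * (2 * R / n) + (1 + √d) / R * ρ ^ 2) + 2 * (√d * R) * (n ^ d * (1 / √N)) ≤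
        rateConst d * ρ / (N : ℝ) ^ rate d := by
  have hN' : (1 : ℝ) ≤ N := by exact_mod_cast hN
  set u : ℝ := (N : ℝ) ^ rate d with hu
  have hu1 : 1 ≤ u := Real.one_le_rpow hN' (rate_pos d).le
  have hu0 : 0 < u := by linarith
  have hu2 : 1 ≤ u ^ 2 := one_le_pow₀ hu1
  have hsq : √N = u ^ (2 * (d + 1)) := by
    rw [Real.sqrt_eq_rpow, hu, ← Real.rpow_natCast, ← Real.rpow_mul (by positivity), rate]
    congr 1
    push_cast
    field_simp
    norm_num
  set n := ⌈u ^ 2⌉₊ with hn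
  have hn1 : u ^ 2 ≤ n := Nat.le_ceil _
  have hn2 : (n : ℝ) ≤ 2 * u ^ 2 := by linarith [Nat.ceil_lt_add_one (sq_nonneg u)]
  refine ⟨n, Nat.ceil_pos.2 (by positivity), ρ * u, by positivity, ?_⟩
  have t1 : 2 * (ρ * u) / n ≤ 2 * ρ / u := by
    calc 2 * (ρ * u) / n ≤ 2 * (ρ * u) / u ^ 2 := by gcongr
      _ = 2 * ρ / u := by field_simp
  have t2 : (1 + √d) / (ρ * u) * ρ ^ 2 = (1 + √d) * ρ / u := by field_simp
  have t3 : 2 * (√d * (ρ * u)) * (n ^ d * (1 / √N)) ≤ 2 ^ (d + 1) * √d * ρ / u := by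
    calc 2 * (√d * (ρ * u)) * (n ^ d * (1 / √N))
        ≤ 2 * (√d * (ρ * u)) * ((2 * u ^ 2) ^ d * (1 / u ^ (2 * (d + 1)))) := by
          rw [hsq]; gcongr
      _ = _ := by
          rw [mul_pow, ← pow_mul, mul_add, pow_add u]
          field_simp
          ring
  calc _ ≤ 2 * (√d * (2 * ρ / u) + (1 + √d) * ρ / u) + 2 ^ (d + 1) * √d * ρ / u := by
        rw [t2]; gcongr
    _ = _ := by rw [rateConst]; ring

theorem lintegral_W1_empirical_le {Ω : Type*} [MeasurableSpace Ω] {P : Measure Ω}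
    [IsProbabilityMeasure P] (hN : 0 < N) {X ξ : Fin N → Ω → E d} (hX : ∀ i, Measurable (X i))
    (hξ : ∀ i, Measurable (ξ i)) (hind : iIndepFun ξ P) (hL : ∀ i, MemLp (ξ i) 2 P) {ρ : ℝ}
    (hρ0 : 0 ≤ ρ) (hρ : ∀ i, ∫ ω, ‖ξ i ω‖ ^ 2 ∂P ≤ ρ ^ 2) :
    ∫⁻ ω, W1 (empiricalMeasure fun i => X i ω) (avgMeasure fun i => P.map (ξ i)) ∂P ≤
      (N : ℝ≥0∞)⁻¹ * ∑ i, ∫⁻ ω, edist (X i ω) (ξ i ω) ∂P +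
      ENNReal.ofReal (rateConst d * ρ / (N : ℝ) ^ rate d) := by
  have hlim : Tendsto (fun r : ℝ => (N : ℝ≥0∞)⁻¹ * ∑ i, ∫⁻ ω, edist (X i ω) (ξ i ω) ∂P +
      ENNReal.ofReal (rateConst d * r / (N : ℝ) ^ rate d)) (𝓝[>] ρ)
      (𝓝 ((N : ℝ≥0∞)⁻¹ * ∑ i, ∫⁻ ω, edist (X i ω) (ξ i ω) ∂P +
        ENNReal.ofReal (rateConst d * ρ / (N : ℝ) ^ rate d))) := by
    refine tendsto_const_nhds.add (ENNReal.tendsto_ofReal ?_)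
    exact ((continuous_const.mul continuous_id).div_const _).continuousAt.mono_left
      nhdsWithin_le_nhds
  -- The choice `R = ρ u` needs `ρ > 0`; letting `r` decrease to `ρ` includes `ρ = 0`.
  refine ge_of_tendsto hlim (eventually_nhdsWithin_of_forall fun r hr => ?_)
  have hr' : ρ < r := hr
  obtain ⟨n, hn, R, hR, h⟩ := grid_cost_le d hN (hρ0.trans_lt hr')
  refine (lintegral_W1_empirical_le_of_grid hN hX hξ hind hL (ρ := r)
    (fun i => (hρ i).trans (by gcongr)) hn hR).trans ?_
  gcongr

end Empirical

end PropIndep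

end

noncomputable section

namespace PropIndep

open Filter Topology

variable {d N : ℕ} {w : Fin N → Fin N → ℝ} {K : E d → E d} {L C A : ℝ≥0}
  {Ω : Type*} [MeasurableSpace Ω] {P : Measure Ω}

/-! ### Fluctuations of the interaction of independent agents -/

section Fluctuation

/-- The deviation of the interaction from its mean over the law `η` of the second agent. -/
def fluctuation (K : E d → E d) (η : Measure (E d)) (x y : E d) : E d :=
  K (x - y) - ∫ z, K (x - z) ∂η

theorem norm_fluctuation_le (hA : ∀ x, ‖K x‖ ≤ A) (η : Measure (E d)) [IsProbabilityMeasure η]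
    (x y : E d) : ‖fluctuation K η x y‖ ≤ 2 * A := by
  refine (norm_sub_le _ _).trans ?_
  have h : ‖∫ z, K (x - z) ∂η‖ ≤ A := by
    simpa using norm_integral_le_of_norm_le_const (μ := η) (.of_forall fun z => hA (x - z))
  linarith [hA (x - y)]

theorem continuous_fluctuation (hK : LipschitzWith L K) (hA : ∀ x, ‖K x‖ ≤ A) (η : Measure (E d))
    [IsProbabilityMeasure η] : Continuous fun p : E d × E d => fluctuation K η p.1 p.2 := by
  have h1 := hK.continuous
  have h2 := (lipschitzWith_integral_translate hK hA η).continuous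
  exact (h1.comp (continuous_fst.sub continuous_snd)).sub (h2.comp continuous_fst)

theorem integral_fluctuation (hK : LipschitzWith L K) (hA : ∀ x, ‖K x‖ ≤ A) (η : Measure (E d))
    [IsProbabilityMeasure η] (x : E d) : ∫ y, fluctuation K η x y ∂η = 0 := by
  have h1 := hK.continuous
  unfold fluctuation
  rw [integral_sub (integrable_of_bound η (by fun_prop) fun y => hA _) (integrable_const _)]
  simp

variable [IsProbabilityMeasure P] {ξ : Fin N → Ω → E d}

/-- Given `(ξ_i, ξ_j)`, integrate over the independent `ξ_k` first: the second factor has mean zero.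
Only `k` must differ from the other two indices, so `j = i` is allowed. -/
theorem integral_inner_fluctuation (hξ : ∀ i, Measurable (ξ i)) (hind : iIndepFun ξ P)
    (hK : LipschitzWith L K) (hA : ∀ x, ‖K x‖ ≤ A) {i j k : Fin N} (hik : i ≠ k) (hjk : j ≠ k) :
    ∫ ω, inner ℝ (fluctuation K (P.map (ξ j)) (ξ i ω) (ξ j ω))
      (fluctuation K (P.map (ξ k)) (ξ i ω) (ξ k ω)) ∂P = 0 := by
  have hp : ∀ i, IsProbabilityMeasure (P.map (ξ i)) := fun i =>
    Measure.isProbabilityMeasure_map (hξ i).aemeasurable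
  have hZ : Measurable fun ω => (ξ i ω, ξ j ω) := (hξ i).prodMk (hξ j)
  have hpZ : IsProbabilityMeasure (P.map fun ω => (ξ i ω, ξ j ω)) :=
    Measure.isProbabilityMeasure_map hZ.aemeasurable
  have hI := (indepFun_iff_map_prod_eq_prod_map_map hZ.aemeasurable (hξ k).aemeasurable).1
    (hind.indepFun_prodMk hξ i j k hik hjk)
  let g : (E d × E d) × E d → ℝ := fun p => inner ℝ (fluctuation K (P.map (ξ j)) p.1.1 p.1.2)
    (fluctuation K (P.map (ξ k)) p.1.1 p.2)
  have c1 := continuous_fluctuation hK hA (P.map (ξ j))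
  have c2 := continuous_fluctuation hK hA (P.map (ξ k))
  have hg : Continuous g :=
    (c1.comp continuous_fst).inner
      (c2.comp ((continuous_fst.comp continuous_fst).prodMk continuous_snd))
  have hgb : ∀ p, ‖g p‖ ≤ (2 * A) * (2 * A) := fun p =>
    (norm_inner_le_norm _ _).trans (mul_le_mul (norm_fluctuation_le hA _ _ _)
      (norm_fluctuation_le hA _ _ _) (norm_nonneg _) (by positivity))
  have e1 : ∫ ω, g ((ξ i ω, ξ j ω), ξ k ω) ∂P =
      ∫ p, g p ∂(P.map fun ω => ((ξ i ω, ξ j ω), ξ k ω)) :=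
    (integral_map (hZ.prodMk (hξ k)).aemeasurable hg.measurable.aestronglyMeasurable).symm
  change ∫ ω, g ((ξ i ω, ξ j ω), ξ k ω) ∂P = 0
  rw [e1, hI, integral_prod _ (integrable_of_bound _ hg hgb)]
  refine integral_eq_zero_of_ae (.of_forall fun p => ?_)
  have c3 : Continuous fun y => fluctuation K (P.map (ξ k)) p.1 y :=
    c2.comp (continuous_const.prodMk continuous_id)
  simp only [g, Pi.zero_apply]
  rw [integral_inner (integrable_of_bound _ c3 fun y => norm_fluctuation_le hA _ _ _),
    integral_fluctuation hK hA, inner_zero_right]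

/-- Expanding the square, the orthogonality of the fluctuations leaves only the diagonal `∑_j w_ij^2
E‖η_j‖^2`. -/
theorem integral_norm_interaction_sub_velocity_le (hξ : ∀ i, Measurable (ξ i))
    (hind : iIndepFun ξ P) (hK : LipschitzWith L K) (hA : ∀ x, ‖K x‖ ≤ A)
    {f : Fin N → ProbabilityMeasure (E d)} (hf : ∀ i, (f i : Measure (E d)) = P.map (ξ i))
    (i : Fin N) :
    ∫ ω, ‖∑ j, w i j • K (ξ i ω - ξ j ω) - velocity w K f i (ξ i ω)‖ ∂P ≤
      2 * A * √(∑ j, w i j ^ 2) := by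
  have hp : ∀ i, IsProbabilityMeasure (P.map (ξ i)) := fun i =>
    Measure.isProbabilityMeasure_map (hξ i).aemeasurable
  let η : Fin N → Ω → E d := fun j ω => fluctuation K (P.map (ξ j)) (ξ i ω) (ξ j ω)
  have hη : ∀ ω, ∑ j, w i j • K (ξ i ω - ξ j ω) - velocity w K f i (ξ i ω) =
      ∑ j, w i j • η j ω := fun ω => by
    rw [velocity, ← Finset.sum_sub_distrib]
    refine Finset.sum_congr rfl fun j _ => ?_
    rw [← smul_sub, hf]
    rfl
  have hηb : ∀ j ω, ‖η j ω‖ ≤ 2 * A := fun j ω => norm_fluctuation_le hA _ _ _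
  have hηm : ∀ j, Measurable (η j) := fun j =>
    (continuous_fluctuation hK hA (P.map (ξ j))).measurable.comp ((hξ i).prodMk (hξ j))
  have hηL : ∀ j, MemLp (η j) 2 P := fun j =>
    MemLp.of_bound (hηm j).aestronglyMeasurable _ (.of_forall (hηb j))
  have hSL : MemLp (fun ω => ∑ j, w i j • η j ω) 2 P :=
    memLp_finsetSum _ fun j _ => (hηL j).const_smul (w i j)
  have hin : ∀ j k, Integrable (fun ω => inner ℝ (η j ω) (η k ω)) P := fun j k =>
    Integrable.of_bound ((hηm j).inner (hηm k)).aestronglyMeasurable ((2 * A) * (2 * A))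
      (.of_forall fun ω => (norm_inner_le_norm _ _).trans
        (mul_le_mul (hηb j ω) (hηb k ω) (norm_nonneg _) (by positivity)))
  have horth : ∀ j k, j ≠ k → ∫ ω, inner ℝ (η j ω) (η k ω) ∂P = 0 := by
    intro j k hjk
    -- The self-interaction term `η_i` need not be centred. Of two distinct indices at least one
    -- differs from `i`, and that one is integrated first.
    by_cases hik : i = k
    · have hij : i ≠ j := fun h => hjk (h.symm.trans hik)
      exact (integral_congr_ae (.of_forall fun ω => real_inner_comm _ _)).trans
        (integral_inner_fluctuation hξ hind hK hA hij hjk.symm)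
    · exact integral_inner_fluctuation hξ hind hK hA hik hjk
  simp_rw [hη]
  refine (integral_norm_le_sqrt hSL).trans ?_
  have e : ∫ ω, ‖∑ j, w i j • η j ω‖ ^ 2 ∂P =
      ∑ j, w i j ^ 2 * ∫ ω, ‖η j ω‖ ^ 2 ∂P := by
    have e1 : ∀ ω, ‖∑ j, w i j • η j ω‖ ^ 2 =
        ∑ j, ∑ k, w i j * w i k * inner ℝ (η j ω) (η k ω) := fun ω => by
      rw [← real_inner_self_eq_norm_sq, sum_inner]
      refine Finset.sum_congr rfl fun j _ => ?_
      rw [inner_sum]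
      refine Finset.sum_congr rfl fun k _ => ?_
      rw [real_inner_smul_left, real_inner_smul_right, mul_assoc]
    simp_rw [e1]
    rw [integral_finsetSum _ fun j _ => integrable_finsetSum _ fun k _ => (hin j k).const_mul _]
    refine Finset.sum_congr rfl fun j _ => ?_
    rw [integral_finsetSum _ fun k _ => (hin j k).const_mul _, Finset.sum_eq_single j]
    · rw [integral_const_mul]
      simp_rw [real_inner_self_eq_norm_sq]
      rw [pow_two]
    · intro k _ hk
      rw [integral_const_mul, horth j k hk.symm, mul_zero]
    · simp
  have hle : ∫ ω, ‖∑ j, w i j • η j ω‖ ^ 2 ∂P ≤ (2 * A) ^ 2 * ∑ j, w i j ^ 2 := by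
    rw [e, Finset.mul_sum]
    refine Finset.sum_le_sum fun j _ => ?_
    rw [mul_comm]
    gcongr
    calc ∫ ω, ‖η j ω‖ ^ 2 ∂P ≤ ∫ _, (2 * (A : ℝ)) ^ 2 ∂P :=
          integral_mono (hηL j).norm.integrable_sq (integrable_const _) fun ω =>
            pow_le_pow_left₀ (norm_nonneg _) (hηb j ω) 2
      _ = _ := by simp
  calc √(∫ ω, ‖∑ j, w i j • η j ω‖ ^ 2 ∂P) ≤ √((2 * A) ^ 2 * ∑ j, w i j ^ 2) :=
        Real.sqrt_le_sqrt hle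
    _ = _ := by rw [Real.sqrt_mul (by positivity), Real.sqrt_sq (by positivity)]

theorem sqrt_sum_sq_le (hw : ∀ i, ∑ j, |w i j| ≤ C) {W : ℝ} (hW : ∀ i j, √|w i j| ≤ W)
    (i : Fin N) : √(∑ j, w i j ^ 2) ≤ √C * W := by
  have hW2 : ∀ j, |w i j| ≤ W ^ 2 := fun j => by
    have := pow_le_pow_left₀ (Real.sqrt_nonneg _) (hW i j) 2
    rwa [Real.sq_sqrt (abs_nonneg _)] at this
  have hW0 : 0 ≤ W := (Real.sqrt_nonneg _).trans (hW i i)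
  have h : ∑ j, w i j ^ 2 ≤ C * W ^ 2 := by
    calc ∑ j, w i j ^ 2 ≤ ∑ j, |w i j| * W ^ 2 := Finset.sum_le_sum fun j _ => by
          rw [← sq_abs, pow_two]
          exact mul_le_mul_of_nonneg_left (hW2 j) (abs_nonneg _)
      _ ≤ _ := by
          rw [← Finset.sum_mul]
          exact mul_le_mul_of_nonneg_right (hw i) (sq_nonneg W)
  calc √(∑ j, w i j ^ 2) ≤ √(C * W ^ 2) := Real.sqrt_le_sqrt h
    _ = √C * W := by rw [Real.sqrt_mul (by positivity), Real.sqrt_sq hW0]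

end Fluctuation

/-! ### Estimates along the flow -/

section Flow

variable {μ : Fin N → ProbabilityMeasure (E d)} {Φ : ℝ → Fin N → E d → E d}
  {f : ℝ → Fin N → ProbabilityMeasure (E d)}

/-- Pulled back to the fixed measure `μ j`, the time dependence sits in the integrand, and dominated
convergence applies. -/
theorem IsMcKeanFlow.continuous_velocity (h : IsMcKeanFlow w K μ Φ f) (hKc : Continuous K)
    (hA : ∀ x, ‖K x‖ ≤ A) (i : Fin N) :
    Continuous fun p : ℝ × E d => velocity w K (f p.1) i p.2 := by
  unfold velocity
  refine continuous_finsetSum _ fun j _ => ?_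
  suffices hc : Continuous fun p : ℝ × E d => ∫ y, K (p.2 - y) ∂(f p.1 j : Measure (E d)) from
    hc.const_smul (w i j)
  have e : ∀ p : ℝ × E d, ∫ y, K (p.2 - y) ∂(f p.1 j : Measure (E d)) =
      ∫ y, K (p.2 - Φ p.1 j y) ∂(μ j : Measure (E d)) := fun p => by
    rw [h.law, integral_map (h.continuous_apply p.1 j).measurable.aemeasurable]
    exact (hKc.comp (continuous_const.sub continuous_id)).measurable.aestronglyMeasurable
  simp_rw [e]
  refine continuous_of_dominated (bound := fun _ => (A : ℝ)) (fun p => ?_)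
    (fun p => .of_forall fun y => hA _) (integrable_const _) (.of_forall fun y => ?_)
  · exact (hKc.comp (continuous_const.sub
      (h.continuous_apply p.1 j))).measurable.aestronglyMeasurable
  · exact hKc.comp (continuous_snd.sub
      ((h.continuous j).comp (continuous_fst.prodMk continuous_const)))

theorem IsMcKeanFlow.norm_apply_le (h : IsMcKeanFlow w K μ Φ f) (hA : ∀ x, ‖K x‖ ≤ A)
    (hw : ∀ i, ∑ j, |w i j| ≤ C) {t : ℝ} (ht : 0 ≤ t) (i : Fin N) (x : E d) :
    ‖Φ t i x‖ ≤ ‖x‖ + C * A * t := by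
  have := norm_image_sub_le_of_norm_deriv_le_segment' (f := fun s => Φ s i x) (a := 0) (b := t)
    (C := C * A) (fun s _ => (h.hasDerivAt s i x).hasDerivWithinAt)
    (fun s _ => norm_velocity_le hA hw (f s) i _) t ⟨ht, le_rfl⟩
  rw [h.zero, sub_zero] at this
  have h2 := norm_le_norm_add_norm_sub' (Φ t i x) x
  linarith

theorem IsMcKeanFlow.memLp (h : IsMcKeanFlow w K μ Φ f) [IsProbabilityMeasure P]
    (hA : ∀ x, ‖K x‖ ≤ A) (hw : ∀ i, ∑ j, |w i j| ≤ C) {t : ℝ} (ht : 0 ≤ t) (i : Fin N)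
    {Y : Ω → E d} (hYm : Measurable Y) (hY : MemLp Y 2 P) : MemLp (fun ω => Φ t i (Y ω)) 2 P := by
  have h1 : MemLp (fun ω => ‖Y ω‖ + C * A * t) 2 P := hY.norm.add (memLp_const _)
  refine h1.mono ((h.continuous_apply t i).measurable.comp hYm).aestronglyMeasurable
    (.of_forall fun ω => ?_)
  exact (h.norm_apply_le hA hw ht i _).trans (le_abs_self _)

theorem IsMcKeanFlow.integral_sq_le (h : IsMcKeanFlow w K μ Φ f) [IsProbabilityMeasure P]
    (hA : ∀ x, ‖K x‖ ≤ A) (hw : ∀ i, ∑ j, |w i j| ≤ C) {t : ℝ} (ht : 0 ≤ t) (i : Fin N)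
    {Y : Ω → E d} (hYm : Measurable Y) (hY : MemLp Y 2 P) {M : ℝ}
    (hM : √(∫ ω, ‖Y ω‖ ^ 2 ∂P) ≤ M) :
    ∫ ω, ‖Φ t i (Y ω)‖ ^ 2 ∂P ≤ 2 * M ^ 2 + 2 * C ^ 2 * A ^ 2 * t ^ 2 := by
  have hM2 : ∫ ω, ‖Y ω‖ ^ 2 ∂P ≤ M ^ 2 :=
    (Real.sqrt_le_left ((Real.sqrt_nonneg _).trans hM)).1 hM
  calc ∫ ω, ‖Φ t i (Y ω)‖ ^ 2 ∂P ≤ ∫ ω, (2 * ‖Y ω‖ ^ 2 + 2 * C ^ 2 * A ^ 2 * t ^ 2) ∂P := by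
        refine integral_mono (h.memLp hA hw ht i hYm hY).norm.integrable_sq
          ((hY.norm.integrable_sq.const_mul 2).add (integrable_const _)) fun ω => ?_
        have h1 := pow_le_pow_left₀ (norm_nonneg _) (h.norm_apply_le hA hw ht i (Y ω)) 2
        simp only
        nlinarith [sq_nonneg (‖Y ω‖ - C * A * t)]
    _ = 2 * ∫ ω, ‖Y ω‖ ^ 2 ∂P + 2 * C ^ 2 * A ^ 2 * t ^ 2 := by
        rw [integral_add (hY.norm.integrable_sq.const_mul 2) (integrable_const _),
          integral_const_mul]
        simp
    _ ≤ _ := by gcongr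

/-- Writing the inhomogeneity as `k c₁` avoids a division and includes `k = 0`, where the bound is
zero. -/
theorem gronwallBound_zero_le {k b t : ℝ} {c₁ c₂ : ℝ} (hk : 0 ≤ k) (ht : 0 ≤ t)
    (hb : b = k * c₁) (hc : c₁ ≤ c₂) :
    gronwallBound 0 k b t ≤ c₂ * (Real.exp (k * t) - 1) := by
  rcases hk.eq_or_lt with h | h
  · rw [hb, ← h, gronwallBound_K0]
    simp
  · rw [gronwallBound_of_K_ne_0 h.ne', hb]
    have : 0 ≤ Real.exp (k * t) - 1 := sub_nonneg.2 (Real.one_le_exp (by positivity))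
    simp only [zero_mul, zero_add]
    rw [mul_div_cancel_left₀ _ h.ne']
    gcongr

/-- Insert the interaction evaluated at the independent copy. The difference from the true
interaction is Lipschitz in the distances `δ_i`, `δ_j`; the difference from the mean-field velocity
is the fluctuation `R`. Grönwall is used for the maximum over `i` of the expectations, so the
supremum stays outside the expectation. -/
theorem IsMcKeanFlow.lintegral_edist_le (h : IsMcKeanFlow w K μ Φ f) [IsProbabilityMeasure P]
    {X : ℝ → Fin N → Ω → E d} (hX : IsAgentSystem P w K X) (hind : iIndepFun (fun i => X 0 i) P)
    (hμ : ∀ i, (μ i : Measure (E d)) = P.map (X 0 i)) {k : ℝ≥0} (hK : LipschitzWith k K)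
    (hA : ∀ x, ‖K x‖ ≤ k) (hw : ∀ i, ∑ j, |w i j| ≤ C) (hC : 0 < C) {W : ℝ}
    (hW : ∀ i j, √|w i j| ≤ W) {T : ℝ} (hT : 0 ≤ T) (i : Fin N) :
    ∫⁻ ω, edist (X T i ω) (Φ T i (X 0 i ω)) ∂P ≤
      ENNReal.ofReal (√(2 / C) * (Real.exp (2 * C * T * k) - 1) * W) := by
  have hW0 : 0 ≤ W := (Real.sqrt_nonneg _).trans (hW i i)
  have hKc := hK.continuous
  have hX0 : ∀ i, Measurable (X 0 i) := hX.measurable 0 le_rfl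
  have hΦc : ∀ i x, Continuous fun s => Φ s i x := fun i x =>
    (h.continuous i).comp (continuous_id.prodMk continuous_const)
  have hΦm : ∀ s i, Measurable fun ω => Φ s i (X 0 i ω) := fun s i =>
    (h.continuous_apply s i).measurable.comp (hX0 i)
  -- On the measurable full set `G` the equation holds at all times. Setting the distance to zero
  -- off `G` and clamping time to `[0, T]` by `σ` makes it continuous in time for every `ω` and
  -- measurable in `ω`, as Fubini requires.
  obtain ⟨G, hG, hGm, hGode⟩ := hX.ode.exists_measurable_mem
  let σ : ℝ → ℝ := fun s => max 0 (min s T)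
  have hσc : Continuous σ := by fun_prop
  have hσ0 : ∀ s, 0 ≤ σ s := fun s => le_max_left _ _
  have hσT : ∀ s, σ s ≤ T := fun s => max_le hT (min_le_right _ _)
  have hσ : ∀ s, 0 ≤ s → s ≤ T → σ s = s := fun s h0 h1 => by
    simp only [σ, min_eq_left h1, max_eq_right h0]
  let δ : ℝ → Fin N → Ω → ℝ := fun s i =>
    G.indicator fun ω => ‖X (σ s) i ω - Φ (σ s) i (X 0 i ω)‖
  have hδG : ∀ s i ω, ω ∈ G → δ s i ω = ‖X (σ s) i ω - Φ (σ s) i (X 0 i ω)‖ := fun s i ω hω =>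
    indicator_of_mem hω _
  have hδG' : ∀ s i ω, ω ∉ G → δ s i ω = 0 := fun s i ω hω => indicator_of_notMem hω _
  have hδ0 : ∀ s i ω, 0 ≤ δ s i ω := fun s i ω => indicator_nonneg (fun _ _ => norm_nonneg _) _
  have hδm : ∀ s i, Measurable (δ s i) := fun s i =>
    ((hX.measurable _ (hσ0 s) i).sub (hΦm _ i)).norm.indicator hGm
  have hδc : ∀ i ω, Continuous fun s => δ s i ω := by
    intro i ω
    by_cases hω : ω ∈ G
    · simp_rw [hδG _ i ω hω]
      have hXc : ContinuousOn (fun s => X s i ω) (Ici 0) := fun s hs =>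
        (hGode ω hω s hs i).continuousWithinAt
      have h1 : Continuous fun s => X (σ s) i ω :=
        hXc.comp_continuous hσc fun s => hσ0 s
      exact (h1.sub ((hΦc i _).comp hσc)).norm
    · simp_rw [hδG' _ i ω hω]
      exact continuous_const
  let R : ℝ → Fin N → Ω → ℝ := fun s i ω =>
    ‖∑ j, w i j • K (Φ s i (X 0 i ω) - Φ s j (X 0 j ω)) - velocity w K (f s) i (Φ s i (X 0 i ω))‖
  have hR0 : ∀ s i ω, 0 ≤ R s i ω := fun s i ω => norm_nonneg _
  have hRc : ∀ i ω, Continuous fun s => R s i ω := fun i ω => by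
    refine Continuous.norm (Continuous.sub (continuous_finsetSum _ fun j _ => ?_) ?_)
    · exact (hKc.comp ((hΦc i _).sub (hΦc j _))).const_smul (w i j)
    · exact (h.continuous_velocity hKc hA i).comp (continuous_id.prodMk (hΦc i _))
  have hRm : ∀ s i, Measurable (R s i) := fun s i => by
    refine Measurable.norm (Measurable.sub (Finset.measurable_fun_sum _ fun j _ => ?_) ?_)
    · exact (hKc.measurable.comp ((hΦm s i).sub (hΦm s j))).const_smul (w i j)
    · exact (lipschitzWith_velocity hK hA hw (f s) i).continuous.measurable.comp (hΦm s i)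
  have hRb : ∀ s i ω, R s i ω ≤ C * k + C * k := fun s i ω =>
    (norm_sub_le _ _).trans (add_le_add (norm_sum_smul_le hw i k.2 fun j => hA _)
      (norm_velocity_le hA hw _ _ _))
  let ρ : ℝ → Fin N → Ω → ℝ := fun s i ω => ∑ j, |w i j| * (k * (δ s i ω + δ s j ω)) + R s i ω
  have hρ0 : ∀ s i ω, 0 ≤ ρ s i ω := fun s i ω =>
    add_nonneg (Finset.sum_nonneg fun j _ => mul_nonneg (abs_nonneg _)
      (mul_nonneg k.2 (add_nonneg (hδ0 s i ω) (hδ0 s j ω)))) (hR0 s i ω)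
  have hρc : ∀ i ω, Continuous fun s => ρ s i ω := fun i ω =>
    (continuous_finsetSum _ fun j _ => continuous_const.mul
      (continuous_const.mul ((hδc i ω).add (hδc j ω)))).add (hRc i ω)
  have hρm : ∀ s i, Measurable (ρ s i) := fun s i =>
    (Finset.measurable_fun_sum _ fun j _ => (((hδm s i).add (hδm s j)).const_mul _).const_mul _).add
      (hRm s i)
  have hder : ∀ i ω, ω ∈ G → ∀ s, 0 ≤ s →
      HasDerivWithinAt (fun s => X s i ω - Φ s i (X 0 i ω))
        (∑ j, w i j • K (X s i ω - X s j ω) - velocity w K (f s) i (Φ s i (X 0 i ω))) (Ici 0) s :=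
    fun i ω hω s hs => (hGode ω hω s hs i).sub (h.hasDerivAt s i _).hasDerivWithinAt
  have hcont : ∀ i ω, ω ∈ G → ContinuousOn (fun s => X s i ω - Φ s i (X 0 i ω)) (Icc 0 T) :=
    fun i ω hω s hs => ((hder i ω hω s hs.1).mono Icc_subset_Ici_self).continuousWithinAt
  have hzero : ∀ i ω, X 0 i ω - Φ 0 i (X 0 i ω) = 0 := fun i ω => by rw [h.zero, sub_self]
  have hδb : ∀ s i ω, δ s i ω ≤ (C * k + C * k) * T := by
    intro s i ω
    by_cases hω : ω ∈ G
    · rw [hδG s i ω hω]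
      have h1 := norm_image_sub_le_of_norm_deriv_right_le_segment (hcont i ω hω)
        (fun r hr => (hder i ω hω r hr.1).mono (Ici_subset_Ici.2 hr.1))
        (C := C * k + C * k) (fun r _ => (norm_sub_le _ _).trans
          (add_le_add (norm_sum_smul_le hw i k.2 fun j => hA _)
            (norm_velocity_le hA hw _ _ _))) (σ s) ⟨hσ0 s, hσT s⟩
      rw [hzero, sub_zero, sub_zero] at h1
      refine h1.trans ?_
      gcongr
      exact hσT s
    · rw [hδG' s i ω hω]
      positivity
  -- A comparison theorem for the norm of a curve replaces differentiation of the norm, which may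
  -- fail where the distance vanishes.
  have hpath : ∀ i ω t, 0 ≤ t → t ≤ T → δ t i ω ≤ ∫ s in (0 : ℝ)..t, ρ s i ω := by
    intro i ω t ht0 htT
    by_cases hω : ω ∈ G
    · rw [hδG t i ω hω, hσ t ht0 htT]
      refine image_norm_le_of_norm_deriv_right_le_deriv_boundary (a := 0) (b := T)
        (f := fun s => X s i ω - Φ s i (X 0 i ω)) (B := fun t => ∫ s in (0 : ℝ)..t, ρ s i ω)
        (B' := fun s => ρ s i ω) (hcont i ω hω)
        (fun r hr => (hder i ω hω r hr.1).mono (Ici_subset_Ici.2 hr.1)) ?_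
        (fun s => intervalIntegral.integral_hasDerivAt_right ((hρc i ω).intervalIntegrable _ _)
          ((hρc i ω).stronglyMeasurableAtFilter _ _) (hρc i ω).continuousAt) ?_ ⟨ht0, htT⟩
      · simp [hzero]
      · intro s hs
        have e : ∑ j, w i j • K (X s i ω - X s j ω) - velocity w K (f s) i (Φ s i (X 0 i ω)) =
            ∑ j, w i j • (K (X s i ω - X s j ω) - K (Φ s i (X 0 i ω) - Φ s j (X 0 j ω))) +
            (∑ j, w i j • K (Φ s i (X 0 i ω) - Φ s j (X 0 j ω)) -
              velocity w K (f s) i (Φ s i (X 0 i ω))) := by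
          simp_rw [smul_sub]
          rw [Finset.sum_sub_distrib]
          abel
        rw [e]
        refine (norm_add_le _ _).trans (add_le_add ((norm_sum_le _ _).trans ?_) le_rfl)
        refine Finset.sum_le_sum fun j _ => ?_
        rw [norm_smul, Real.norm_eq_abs, hδG s i ω hω, hδG s j ω hω, hσ s hs.1 hs.2.le]
        gcongr
        refine (hK.norm_sub_le _ _).trans ?_
        gcongr
        rw [sub_sub_sub_comm]
        exact norm_sub_le _ _
    · rw [hδG' t i ω hω]
      exact intervalIntegral.integral_nonneg ht0 fun s _ => hρ0 s i ω
  have hδI : ∀ s i, Integrable (δ s i) P := fun s i =>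
    Integrable.of_bound (hδm s i).aestronglyMeasurable ((C * k + C * k) * T)
      (.of_forall fun ω => by rw [Real.norm_of_nonneg (hδ0 s i ω)]; exact hδb s i ω)
  have hRI : ∀ s i, Integrable (R s i) P := fun s i =>
    Integrable.of_bound (hRm s i).aestronglyMeasurable (C * k + C * k)
      (.of_forall fun ω => by rw [Real.norm_of_nonneg (hR0 s i ω)]; exact hRb s i ω)
  let e : ℝ → Fin N → ℝ := fun s i => ∫ ω, δ s i ω ∂P
  have hec : Continuous e := continuous_pi fun i =>
    continuous_of_dominated (bound := fun _ => (C * k + C * k) * T)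
      (fun s => (hδm s i).aestronglyMeasurable)
      (fun s => .of_forall fun ω => by rw [Real.norm_of_nonneg (hδ0 s i ω)]; exact hδb s i ω)
      (integrable_const _) (.of_forall fun ω => hδc i ω)
  have he0 : ∀ s i, 0 ≤ e s i := fun s i => integral_nonneg fun ω => hδ0 s i ω
  have hele : ∀ s i, e s i ≤ ‖e s‖ := fun s i => (le_abs_self _).trans (norm_le_pi_norm (e s) i)
  -- The fluctuation bound `2 k √C W`, written as a multiple of the Grönwall rate `2 C k`.
  set b : ℝ := 2 * C * k * (W / √C) with hb
  have hRE : ∀ s i, ∫ ω, R s i ω ∂P ≤ b := by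
    intro s i
    have h1 := integral_norm_interaction_sub_velocity_le (P := P) (w := w)
      (ξ := fun i ω => Φ s i (X 0 i ω)) (hΦm s)
      (hind.comp (fun i => Φ s i) fun i => (h.continuous_apply s i).measurable) hK hA (f := f s)
      (fun i => by
        rw [h.law, hμ, Measure.map_map (h.continuous_apply s i).measurable (hX0 i)]; rfl) i
    have hC' : (0 : ℝ) < √C := Real.sqrt_pos.2 hC
    refine h1.trans ((mul_le_mul_of_nonneg_left (sqrt_sum_sq_le hw hW i)
      (by positivity)).trans_eq ?_)
    have h2 : (C : ℝ) = √C * √C := (Real.mul_self_sqrt C.2).symm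
    rw [hb]
    field_simp
    rw [pow_two, ← h2]
    ring
  have hρE : ∀ s i, ∫ ω, ρ s i ω ∂P ≤ 2 * C * k * ‖e s‖ + b := by
    intro s i
    have i1 : ∀ j, Integrable (fun ω => |w i j| * (k * (δ s i ω + δ s j ω))) P := fun j =>
      (((hδI s i).add (hδI s j)).const_mul _).const_mul _
    have e1 : ∫ ω, ρ s i ω ∂P = ∑ j, |w i j| * (k * (e s i + e s j)) + ∫ ω, R s i ω ∂P := by
      simp only [ρ]
      rw [integral_add (integrable_finsetSum _ fun j _ => i1 j) (hRI s i),
        integral_finsetSum _ fun j _ => i1 j]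
      congr 1
      refine Finset.sum_congr rfl fun j _ => ?_
      rw [integral_const_mul, integral_const_mul, integral_add (hδI s i) (hδI s j)]
    rw [e1]
    refine add_le_add ?_ (hRE s i)
    calc ∑ j, |w i j| * (k * (e s i + e s j)) ≤ ∑ j, |w i j| * (k * (‖e s‖ + ‖e s‖)) := by
          gcongr with j
          · exact hele s i
          · exact hele s j
      _ = (∑ j, |w i j|) * (2 * k * ‖e s‖) := by rw [Finset.sum_mul]; congr 1; ext j; ring
      _ ≤ C * (2 * k * ‖e s‖) := by gcongr; exact hw i
      _ = _ := by ring
  -- Grönwall in differential form is applied to the integral `g`, which is differentiable and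
  -- dominates `e`.
  let g : ℝ → ℝ := fun t => ∫ s in (0 : ℝ)..t, (2 * C * k * ‖e s‖ + b)
  have hgc : Continuous fun s => 2 * C * k * ‖e s‖ + b := by fun_prop
  have hgd : ∀ t, HasDerivAt g (2 * C * k * ‖e t‖ + b) t := fun t =>
    intervalIntegral.integral_hasDerivAt_right (hgc.intervalIntegrable _ _)
      (hgc.stronglyMeasurableAtFilter _ _) hgc.continuousAt
  have heg : ∀ t, 0 ≤ t → t ≤ T → ∀ i, e t i ≤ g t := by
    intro t ht0 htT i
    have hρb : ∀ s ω, ‖ρ s i ω‖ ≤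
        ∑ j, |w i j| * (k * ((C * k + C * k) * T + (C * k + C * k) * T)) + (C * k + C * k) := by
      intro s ω
      rw [Real.norm_of_nonneg (hρ0 s i ω)]
      refine add_le_add (Finset.sum_le_sum fun j _ => ?_) (hRb s i ω)
      gcongr
      · exact hδb s i ω
      · exact hδb s j ω
    have hρu : Measurable (Function.uncurry fun s ω => ρ s i ω) :=
      measurable_uncurry_of_continuous_of_measurable (fun ω => hρc i ω) fun s => hρm s i
    have hρI : Integrable (Function.uncurry fun s ω => ρ s i ω)
        ((volume.restrict (Ioc 0 t)).prod P) :=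
      Integrable.of_bound hρu.aestronglyMeasurable _ (.of_forall fun p => hρb p.1 p.2)
    have hinner : Integrable (fun ω => ∫ s in Ioc 0 t, ρ s i ω) P := hρI.integral_prod_right
    calc e t i ≤ ∫ ω, (∫ s in Ioc 0 t, ρ s i ω) ∂P :=
          integral_mono (hδI t i) hinner fun ω => by
            have := hpath i ω t ht0 htT
            rwa [intervalIntegral.integral_of_le ht0] at this
      _ = ∫ s in Ioc 0 t, (∫ ω, ρ s i ω ∂P) := (integral_integral_swap hρI).symm
      _ ≤ ∫ s in Ioc 0 t, (2 * C * k * ‖e s‖ + b) :=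
          integral_mono hρI.integral_prod_left
            (hgc.intervalIntegrable 0 t).1 fun s => hρE s i
      _ = g t := (intervalIntegral.integral_of_le ht0).symm
  have hg0 : ∀ t, 0 ≤ t → 0 ≤ g t := fun t ht =>
    intervalIntegral.integral_nonneg ht fun s _ => by positivity
  have hgb := norm_le_gronwallBound_of_norm_deriv_right_le (f := g) (a := 0) (b := T)
    (δ := 0) (K := 2 * C * k) (ε := b) (fun t _ => (hgd t).continuousAt.continuousWithinAt)
    (fun t _ => (hgd t).hasDerivWithinAt) (by simp [g]) (fun t ht => by
      rw [Real.norm_of_nonneg (by positivity)]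
      have : ‖e t‖ ≤ ‖g t‖ := by
        rw [Real.norm_of_nonneg (hg0 t ht.1)]
        refine (pi_norm_le_iff_of_nonneg (hg0 t ht.1)).2 fun i => ?_
        rw [Real.norm_of_nonneg (he0 t i)]
        exact heg t ht.1 ht.2.le i
      gcongr) T ⟨hT, le_rfl⟩
  have hfin : e T i ≤ √(2 / C) * (Real.exp (2 * C * T * k) - 1) * W := by
    have h1 := (heg T hT le_rfl i).trans ((le_abs_self _).trans hgb)
    -- The argument yields the factor `1 / √C`; the stated `√(2 / C)` is larger.
    have h2 : W / √C ≤ √(2 / C) * W := by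
      rw [div_eq_mul_inv, mul_comm, ← Real.sqrt_inv]
      gcongr
      rw [inv_eq_one_div]
      gcongr
      norm_num
    refine (h1.trans (gronwallBound_zero_le (by positivity) (by simpa using hT) hb h2)).trans_eq ?_
    rw [sub_zero, show (2 : ℝ) * C * k * T = 2 * C * T * k by ring]
    ring
  have hae : ∫⁻ ω, edist (X T i ω) (Φ T i (X 0 i ω)) ∂P = ∫⁻ ω, ENNReal.ofReal (δ T i ω) ∂P := by
    refine lintegral_congr_ae ?_
    filter_upwards [hG] with ω hω
    rw [hδG T i ω hω, hσ T hT le_rfl, edist_dist, dist_eq_norm]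
  rw [hae, ← ofReal_integral_eq_lintegral_ofReal (hδI T i) (.of_forall fun ω => hδ0 T i ω)]
  exact ENNReal.ofReal_le_ofReal hfin

end Flow

/-! ### Wasserstein bound from a joint law, and the norms of `K` -/

theorem W1_map_le {Y Z : Ω → E d} (hY : Measurable Y) (hZ : Measurable Z) :
    W1 (P.map Y) (P.map Z) ≤ ∫⁻ ω, edist (Y ω) (Z ω) ∂P := by
  have hYZ := hY.prodMk hZ
  have g1 : (P.map fun ω => (Y ω, Z ω)).map Prod.fst = P.map Y := by
    rw [Measure.map_map measurable_fst hYZ]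
    rfl
  have g2 : (P.map fun ω => (Y ω, Z ω)).map Prod.snd = P.map Z := by
    rw [Measure.map_map measurable_snd hYZ]
    rfl
  refine (iInf₂_le (P.map fun ω => (Y ω, Z ω)) ⟨g1, g2⟩).trans_eq ?_
  rw [lintegral_map (measurable_fst.edist measurable_snd) hYZ]

theorem MemW1Inf.norm_le (hK : MemW1Inf K) (x : E d) : ‖K x‖ ≤ normLInf K := by
  obtain ⟨B, hB⟩ := hK.bounded
  exact le_ciSup (f := fun x => ‖K x‖) ⟨B, by rintro _ ⟨x, rfl⟩; exact hB x⟩ x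

/-- The infimum is attained, because every difference quotient is a lower bound of the set of
Lipschitz constants. -/
theorem MemW1Inf.lipschitzWith (hK : MemW1Inf K) :
    LipschitzWith (sInf {L : ℝ≥0 | LipschitzWith L K}) K := by
  obtain ⟨L₀, hL₀⟩ := hK.lipschitz
  refine LipschitzWith.of_dist_le_mul fun x y => ?_
  rcases eq_or_ne x y with rfl | h
  · simp
  · have hpos : 0 < dist x y := dist_pos.2 h
    rw [← div_le_iff₀ hpos]
    have hq : 0 ≤ dist (K x) (K y) / dist x y := by positivity
    rw [← Real.coe_toNNReal _ hq, NNReal.coe_le_coe]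
    refine le_csInf ⟨L₀, hL₀⟩ fun L hL => ?_
    rw [Real.toNNReal_le_iff_le_coe, div_le_iff₀ hpos]
    exact LipschitzWith.dist_le_mul hL x y

end PropIndep

end

/-! ### Proof of the theorem -/

theorem proposition2p2 (d : ℕ) :
    ∃ Ctilde θ : ℝ, 0 < Ctilde ∧ 0 < θ ∧
      ∀ (N : ℕ) (_ : 0 < N) (Ω : Type*) [MeasurableSpace Ω] (P : Measure Ω)
        [IsProbabilityMeasure P] (K : PropIndep.E d → PropIndep.E d) (_ : PropIndep.MemW1Inf K)
        (w : Fin N → Fin N → ℝ) (X : ℝ → Fin N → Ω → PropIndep.E d)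
        (_ : PropIndep.IsAgentSystem P w K X)
        (_ : iIndepFun (fun i => X 0 i) P)
        (_ : ∀ i, MemLp (X 0 i) 2 P)
        (M C : ℝ) (_ : 0 < C)
        (_ : ∀ i, √(∫ ω, ‖X 0 i ω‖ ^ 2 ∂P) ≤ M)
        (_ : ∀ i, ∑ j, |w i j| ≤ C),
        ∃ fbar : ℝ → Fin N → ProbabilityMeasure (PropIndep.E d),
          PropIndep.IsMcKeanSolution w K (fun i => P.map (X 0 i)) fbar ∧
          (∀ g, PropIndep.IsMcKeanSolution w K (fun i => P.map (X 0 i)) g →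
            ∀ t, 0 ≤ t → g t = fbar t) ∧
          ∀ t, 0 ≤ t →
            ((⨆ i, PropIndep.W1 (P.map (X t i)) (fbar t i : Measure (PropIndep.E d))) ≤
              ENNReal.ofReal (PropIndep.C1 C K t * (⨆ i, ⨆ j, √|w i j|))) ∧
            ((∫⁻ ω, PropIndep.W1 (PropIndep.empiricalMeasure fun i => X t i ω)
                (PropIndep.avgMeasure fun i => (fbar t i : Measure (PropIndep.E d))) ∂P) ≤
              ENNReal.ofReal (Ctilde * PropIndep.C2 M C K t / (N : ℝ) ^ θ +
                PropIndep.C1 C K t * (⨆ i, ⨆ j, √|w i j|))) := by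
  refine ⟨PropIndep.rateConst d, PropIndep.rate d, PropIndep.rateConst_pos d,
    PropIndep.rate_pos d, ?_⟩
  intro N hN Ω _ P _ K hK w X hX hind hL M C hC hM hw
  have hX0 : ∀ i, Measurable (X 0 i) := hX.measurable 0 le_rfl
  let μ : Fin N → ProbabilityMeasure (PropIndep.E d) := fun i =>
    ⟨P.map (X 0 i), Measure.isProbabilityMeasure_map (hX0 i).aemeasurable⟩
  lift C to ℝ≥0 using hC.le
  have hA0 : 0 ≤ PropIndep.normLInf K := (norm_nonneg _).trans (hK.norm_le 0)
  -- Two bounds for `K` are kept: the sup norm `A` for the second moments in `C2`, and `k`, which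
  -- bounds both the size and the slope of `K`, for the exponential in `C1`.
  obtain ⟨A, hAeq⟩ : ∃ A : ℝ≥0, (A : ℝ) = PropIndep.normLInf K := ⟨⟨_, hA0⟩, rfl⟩
  have hA : ∀ x, ‖K x‖ ≤ A := fun x => hAeq ▸ hK.norm_le x
  obtain ⟨k, hk⟩ : ∃ k : ℝ≥0, (k : ℝ) = PropIndep.normW1Inf K :=
    ⟨⟨_, hA0.trans (le_max_left _ _)⟩, rfl⟩
  have hkA : ∀ x, ‖K x‖ ≤ k := fun x => by
    rw [hk]; exact (hK.norm_le x).trans (le_max_left _ _)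
  have hkL : LipschitzWith k K := hK.lipschitzWith.weaken (by
    rw [← NNReal.coe_le_coe, hk]; exact le_max_right _ _)
  obtain ⟨Φ, f, h⟩ := PropIndep.exists_mcKeanFlow hkL hkA hw μ
  have hsol := h.isMcKeanSolution hkL hkA hw
  have hW : ∀ i j, √|w i j| ≤ ⨆ i, ⨆ j, √|w i j| := fun i j =>
    (le_ciSup (f := fun j => √|w i j|) (Set.finite_range _).bddAbove j).trans
      (le_ciSup (f := fun i => ⨆ j, √|w i j|) (Set.finite_range _).bddAbove i)
  refine ⟨f, hsol, fun g hg t ht => hg.unique hsol hkL hkA hw ht, fun t ht => ?_⟩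
  have hdist : ∀ i, ∫⁻ ω, edist (X t i ω) (Φ t i (X 0 i ω)) ∂P ≤
      ENNReal.ofReal (PropIndep.C1 C K t * (⨆ i, ⨆ j, √|w i j|)) := fun i => by
    rw [PropIndep.C1, ← hk]
    exact h.lintegral_edist_le hX hind (fun i => rfl) hkL hkA hw hC hW ht i
  have hΦm : ∀ i, Measurable fun ω => Φ t i (X 0 i ω) := fun i =>
    (h.continuous_apply t i).measurable.comp (hX0 i)
  have hlaw : ∀ i, (f t i : Measure (PropIndep.E d)) = P.map fun ω => Φ t i (X 0 i ω) := fun i => by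
    rw [h.law]
    exact Measure.map_map (h.continuous_apply t i).measurable (hX0 i)
  constructor
  · refine iSup_le fun i => ?_
    rw [hlaw]
    exact (PropIndep.W1_map_le (hX.measurable t ht i) (hΦm i)).trans (hdist i)
  · have hC2 : PropIndep.C2 M C K t ^ 2 =
        2 * M ^ 2 + 2 * (C : ℝ) ^ 2 * (A : ℝ) ^ 2 * t ^ 2 := by
      rw [PropIndep.C2, Real.sq_sqrt (by positivity), hAeq]
    have hC20 : 0 ≤ PropIndep.C2 M C K t := Real.sqrt_nonneg _
    -- The points `Φ_t^i(X_i(0))` remain independent, since each is a function of its own initial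
    -- value; their second moments are at most `C2 ^ 2`.
    have hemp := PropIndep.lintegral_W1_empirical_le (P := P) hN (X := fun i => X t i)
      (ξ := fun i ω => Φ t i (X 0 i ω)) (fun i => hX.measurable t ht i) hΦm
      (hind.comp (fun i => Φ t i) fun i => (h.continuous_apply t i).measurable)
      (fun i => h.memLp hA hw ht i (hX0 i) (hL i)) hC20
      (fun i => by rw [hC2]; exact h.integral_sq_le hA hw ht i (hX0 i) (hL i) (hM i))
    simp_rw [hlaw]
    refine hemp.trans ?_
    rw [add_comm, ENNReal.ofReal_add]
    · gcongr
      exact PropIndep.inv_mul_sum_le_const hN hdist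
    · have := PropIndep.rateConst_pos d
      positivity
    · have : 0 ≤ Real.exp (2 * C * t * PropIndep.normW1Inf K) - 1 := by
        rw [← hk]
        exact sub_nonneg.2 (Real.one_le_exp (by positivity))
      exact mul_nonneg (mul_nonneg (Real.sqrt_nonneg _) this)
        ((Real.sqrt_nonneg _).trans (hW ⟨0, hN⟩ ⟨0, hN⟩))
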